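/- **Proposition (Norm of the global jump lifting).** Let $d\in\{2,3\}$, let $k\ge 1$ be an integer, let $q\in[1,\infty)$ and let $\varrho$ be a real number. There exist constants $c,C>0$, depending only on $d$, $k$, $q$ and $\varrho$, such that the following holds. Let $\Omega\subset\mathbb{R}^d$ be an open, bounded, connected polygonal or polyhedral domain lying on one side of its boundary (i.e. $\Omega$ is the interior of $\overline\Omega$), and let $\mathcal{T}_h$ be a conforming mesh of $\overline\Omega$ made of finitely many closed nondegenerate $d$-simplices, with set of faces $\mathcal{F}_h$. Assume that it has regularity parameter $\varrho$: every $T\in\mathcal{T}_h$ contains a ball of diameter $\delta>0$ with $h_T\le\varrho\,\delta$, where $h_Y$ denotes the diameter of $Y$. For each $F\in\mathcal{F}_h$ fix a unit normal $\boldsymbol{n}_F$, pointing out of $\Omega$ if $F\subset\partial\Omega$. On an interface $F$ shared by $T_1$ and $T_2$, with $\boldsymbol{n}_F$ pointing out of $T_1$, set $[\boldsymbol{v}]:=\boldsymbol{v}_{|T_1}-\boldsymbol{v}_{|T_2}$ and $\{\boldsymbol{v}\}:=\frac12(\boldsymbol{v}_{|T_1}+\boldsymbol{v}_{|T_2})$;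 on a boundary face set $[\boldsymbol{v}]:=\{\boldsymbol{v}\}:=\boldsymbol{v}$. Let $\boldsymbol{\mathcal P}^k(\mathcal{T}_h)$ denote the vector- or tensor-valued functions whose components are, on each element, polynomials of total degree at most $k$. For $\boldsymbol{w}\in L^1(F)^d$ let $\boldsymbol{r}_F^k(\boldsymbol{w})$ be the unique tensor field in $\boldsymbol{\mathcal P}^k(\mathcal{T}_h)$ such that $$\int_\Omega \boldsymbol{r}_F^k(\boldsymbol{w}):\boldsymbol{\tau}_h=\int_F\boldsymbol{w}\cdot(\{\boldsymbol{\tau}_h\}\boldsymbol{n}_F)\qquad\text{for all tensor-valued }\boldsymbol{\tau}_h\in\boldsymbol{\mathcal P}^k(\mathcal{T}_h),$$ and set $\boldsymbol{R}_h^k\boldsymbol{v}:=\sum_{F\in\mathcal{F}_h}\boldsymbol{r}_F^k([\boldsymbol{v}])$. Let $\boldsymbol{V}_h^k$ be the space of vector fields $\boldsymbol{v}_h\in\boldsymbol{\mathcal P}^k(\mathcal{T}_h)\cap\boldsymbol{H}(\operatorname{div};\Omega)$ whose normal trace vanishes on $\partial\Omega$. Then, for all $\boldsymbol{v}_h\in\boldsymbol{V}_h^k$,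 $$c\sum_{F\in\mathcal{F}_h}h_F^{1-q}\,\|[\boldsymbol{v}_h]\|_{L^q(F)}^q\;\le\;\|\boldsymbol{R}_h^k\boldsymbol{v}_h\|_{L^q(\Omega)}^q\;\le\;C\sum_{F\in\mathcal{F}_h}h_F^{1-q}\,\|[\boldsymbol{v}_h]\|_{L^q(F)}^q,$$ where $L^q$ norms use the Euclidean norm of vectors and the Frobenius norm of tensors. -/

import Mathlib

open MeasureTheory
open scoped Matrix.Norms.Frobenius

noncomputable section

namespace HdivDG

/-- The ambient space `ℝ^d` with the Euclidean norm. -/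
abbrev Pt (d : ℕ) := EuclideanSpace ℝ (Fin d)

/-- Open, bounded, connected (nonempty) set lying on one side of its boundary (no slits).
That the closure is a polytope is part of the existence of a simplicial mesh of it. -/
structure IsPolytopalDomain {d : ℕ} (Ω : Set (Pt d)) : Prop where
  isOpen : IsOpen Ω
  isConnected : IsConnected Ω
  isBounded : Bornology.IsBounded Ω
  interior_closure : interior (closure Ω) = Ω

/-- A conforming simplicial mesh of `Ω`: a finite geometric simplicial complex (two simplices meet
along the common face spanned by their common vertices) all of whose simplices are
faces of `d`-simplices, and which covers the closure of `Ω`.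
Simplices are given by their sets of vertices. -/
structure SimplicialMesh {d : ℕ} (Ω : Set (Pt d)) extends
    Geometry.SimplicialComplex ℝ (Pt d) where
  finite_faces : faces.Finite
  pure : ∀ s ∈ faces, ∃ t ∈ faces, s ⊆ t ∧ t.card = d + 1
  space_eq : toSimplicialComplex.space = closure Ω

/-- The closed simplex with the given vertices. -/
abbrev cell {d : ℕ} (s : Finset (Pt d)) : Set (Pt d) := convexHull ℝ (s : Set (Pt d))

/-- The Frobenius product `A : B`. -/
def frobProd {d : ℕ} (A B : Matrix (Fin d) (Fin d) ℝ) : ℝ := ∑ i, ∑ j, A i j * B i j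

/-- `u` has weak divergence `g` in `Ω`. -/
def HasWeakDivergence {d : ℕ} (Ω : Set (Pt d)) (u : Pt d → Pt d) (g : Pt d → ℝ) : Prop :=
  ∀ φ : Pt d → ℝ, ContDiff ℝ (⊤ : ℕ∞) φ → HasCompactSupport φ → tsupport φ ⊆ Ω →
    ∫ x in Ω, fderiv ℝ φ x (u x) = - ∫ x in Ω, g x * φ x

/-- Membership in `H(div; Ω)`. -/
def MemHdiv {d : ℕ} (Ω : Set (Pt d)) (u : Pt d → Pt d) : Prop :=
  MemLp u 2 (volume.restrict Ω) ∧
    ∃ g : Pt d → ℝ, MemLp g 2 (volume.restrict Ω) ∧ HasWeakDivergence Ω u g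

namespace SimplicialMesh

variable {d : ℕ} {Ω : Set (Pt d)} (M : SimplicialMesh Ω)

/-- The mesh elements: the `d`-simplices. -/
def elements : Finset (Finset (Pt d)) := M.finite_faces.toFinset.filter fun s => s.card = d + 1

/-- The mesh faces: the `(d-1)`-simplices. -/
def meshFaces : Finset (Finset (Pt d)) := M.finite_faces.toFinset.filter fun s => s.card = d

/-- The type of mesh elements. -/
abbrev Elt := {T : Finset (Pt d) // T ∈ M.elements}

open Classical in
/-- The elements sharing the face `F`: two for an interface, one for a boundary face. -/
def elementsOf (F : Finset (Pt d)) : Finset M.Elt := Finset.univ.filter fun T => F ⊆ T.1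

/-- `F` is contained in the boundary of the domain. -/
def IsBoundaryFace (_M : SimplicialMesh Ω) (F : Finset (Pt d)) : Prop := cell F ⊆ frontier Ω

/-- Mesh regularity with parameter `ϱ`: every element `T` contains a ball whose diameter `2r`
satisfies `h_T ≤ ϱ (2r)`. -/
def IsRegular (ϱ : ℝ) : Prop :=
  ∀ T ∈ M.elements, ∃ (x : Pt d) (r : ℝ), 0 < r ∧ Metric.ball x r ⊆ cell T ∧
    Metric.diam (cell T) ≤ ϱ * (2 * r)

/-- The vector `ν`, normal to the face `F` of `T`, points out of `T`. -/
def PointsOut (ν : Pt d) (F T : Finset (Pt d)) : Prop :=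
  ∀ x ∈ F, ∀ y ∈ T, y ∉ F → inner ℝ ν (y - x) < 0

/-- A choice of unit normals `n_F` of the mesh faces: the orientation is arbitrary on interfaces
and outward on boundary faces. -/
structure FaceNormals where
  normal : Finset (Pt d) → Pt d
  norm_normal : ∀ F ∈ M.meshFaces, ‖normal F‖ = 1
  orthogonal : ∀ F ∈ M.meshFaces, ∀ x ∈ F, ∀ y ∈ F, inner ℝ (normal F) (y - x) = 0
  outward : ∀ F ∈ M.meshFaces, M.IsBoundaryFace F →
    ∀ T ∈ M.elementsOf F, PointsOut (normal F) F T.1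

variable {M}

open Classical in
/-- The jump on `F` of a function given by its restrictions to the elements. If `F` is an interface
shared by `T₁` and `T₂`, and `n_F` points out of `T₁`, this is `v_{T₁} - v_{T₂}`; if `F` is a
boundary face of `T`, this is `v_T`. -/
def jump {V : Type*} [AddCommGroup V] [Module ℝ V] (n : M.FaceNormals) (F : Finset (Pt d))
    (v : M.Elt → Pt d → V) (x : Pt d) : V :=
  ∑ T ∈ M.elementsOf F, (if PointsOut (n.normal F) F T.1 then (1 : ℝ) else -1) • v T x

/-- The average on `F`: `(v_{T₁} + v_{T₂}) / 2` on an interface, `v_T` on a boundary face. -/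
def avg {V : Type*} [AddCommGroup V] [Module ℝ V] (F : Finset (Pt d))
    (v : M.Elt → Pt d → V) (x : Pt d) : V :=
  ((M.elementsOf F).card : ℝ)⁻¹ • ∑ T ∈ M.elementsOf F, v T x

/-- The function on `Ω` (up to the null set of the element boundaries) given by its restrictions
to the elements. -/
def glue {V : Type*} [AddCommGroup V] (v : M.Elt → Pt d → V) (x : Pt d) : V :=
  ∑ T : M.Elt, (interior (cell T.1)).indicator (v T) x

variable (M) in
/-- Broken polynomials of total degree at most `k` with components indexed by `ι`:
one polynomial for each element and each component. -/
abbrev BrokenPoly (k : ℕ) (ι : Type) : Type :=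
  M.Elt → ι → MvPolynomial.restrictTotalDegree (Fin d) ℝ k

/-- The restrictions to the elements of a vector-valued broken polynomial (each extended to
`ℝ^d`, so that its trace on a face is its restriction to the face). -/
def evalVec {k : ℕ} (v : M.BrokenPoly k (Fin d)) (T : M.Elt) (x : Pt d) : Pt d :=
  WithLp.toLp 2 fun i => MvPolynomial.eval x.ofLp (v T i : MvPolynomial (Fin d) ℝ)

/-- The restrictions to the elements of a tensor-valued broken polynomial. -/
def evalMat {k : ℕ} (τ : M.BrokenPoly k (Fin d × Fin d)) (T : M.Elt) (x : Pt d) :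
    Matrix (Fin d) (Fin d) ℝ :=
  Matrix.of fun i j => MvPolynomial.eval x.ofLp (τ T (i, j) : MvPolynomial (Fin d) ℝ)

variable (M) in
/-- The Brezzi--Douglas--Marini space of degree `k`. -/
def BDM (k : ℕ) : Set (M.BrokenPoly k (Fin d)) := {v | MemHdiv Ω (glue (evalVec v))}

/-- The discrete velocity space: `BDM` fields with vanishing normal trace on the boundary. -/
def velocitySpace (n : M.FaceNormals) (k : ℕ) : Set (M.BrokenPoly k (Fin d)) :=
  {v | v ∈ M.BDM k ∧ ∀ F ∈ M.meshFaces, M.IsBoundaryFace F → ∀ T ∈ M.elementsOf F,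
    ∀ x ∈ cell F, inner ℝ (evalVec v T x) (n.normal F) = 0}

/-- `r` satisfies the equation defining the lifting of the face function `w`:
`∫_Ω r : τ = ∫_F w · ({τ} n_F)` for all broken tensor polynomials `τ` of degree `k`.
The measure on `F` is the `(d-1)`-dimensional surface measure. -/
def IsFaceLifting {k : ℕ} (n : M.FaceNormals) (F : Finset (Pt d)) (w : Pt d → Pt d)
    (r : M.BrokenPoly k (Fin d × Fin d)) : Prop :=
  ∀ τ : M.BrokenPoly k (Fin d × Fin d),
    ∫ x in Ω, frobProd (glue (evalMat r) x) (glue (evalMat τ) x) =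
      ∫ x in cell F, inner ℝ (w x)
        (WithLp.toLp 2 ((avg F (evalMat τ) x).mulVec (n.normal F).ofLp)) ∂μHE[d - 1]

open Classical in
/-- The local lifting `r_F^k(w)`: the unique solution of the equation above when `w` is integrable
on `F` (see `existsUnique_isFaceLifting`). -/
def faceLifting (k : ℕ) (n : M.FaceNormals) (F : Finset (Pt d)) (w : Pt d → Pt d) :
    M.BrokenPoly k (Fin d × Fin d) :=
  if h : ∃ r : M.BrokenPoly k (Fin d × Fin d), IsFaceLifting n F w r then h.choose else 0

/-- The global face jumps lifting `R_h^k v = ∑_F r_F^k([v])`. -/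
def jumpLifting (k : ℕ) (n : M.FaceNormals) (v : M.Elt → Pt d → Pt d) :
    M.BrokenPoly k (Fin d × Fin d) :=
  ∑ F ∈ M.meshFaces, faceLifting k n F (jump n F v)

/-! ### The local lifting is well defined -/

lemma elt_mem_faces (T : M.Elt) : T.1 ∈ M.faces := by
  have := T.2
  simp only [elements, Finset.mem_filter, Set.Finite.mem_toFinset] at this
  exact this.1

lemma elt_card (T : M.Elt) : T.1.card = d + 1 := by
  have := T.2
  simp only [elements, Finset.mem_filter] at this
  exact this.2

lemma interior_cell_nonempty (T : M.Elt) : (interior (cell T.1)).Nonempty := by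
  rw [interior_convexHull_nonempty_iff_affineSpan_eq_top]
  have h := (M.indep (elt_mem_faces T)).affineSpan_eq_top_iff_card_eq_finrank_add_one
  simp only [Subtype.range_coe_subtype, Fintype.card_coe, finrank_euclideanSpace,
    Fintype.card_fin] at h
  exact h.2 (elt_card T)

lemma interior_cell_subset (hΩ : IsPolytopalDomain Ω) (T : M.Elt) : interior (cell T.1) ⊆ Ω := by
  have h : cell T.1 ⊆ closure Ω := by
    rw [← M.space_eq]
    exact Geometry.SimplicialComplex.convexHull_subset_space (elt_mem_faces T)
  exact (interior_mono h).trans hΩ.interior_closure.subset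

open Classical in
lemma interior_cell_disjoint {T T' : M.Elt} {x : Pt d} (hx : x ∈ interior (cell T.1))
    (hx' : x ∈ interior (cell T'.1)) : T = T' := by
  have hsub : interior (cell T.1) ∩ interior (cell T'.1) ⊆
      convexHull ℝ ((T.1 ∩ T'.1 : Finset (Pt d)) : Set (Pt d)) := by
    rw [Finset.coe_inter]
    exact (Set.inter_subset_inter interior_subset interior_subset).trans
      (M.inter_subset_convexHull (elt_mem_faces T) (elt_mem_faces T'))
  have hne : (interior (convexHull ℝ ((T.1 ∩ T'.1 : Finset (Pt d)) : Set (Pt d)))).Nonempty :=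
    ⟨x, interior_maximal hsub (isOpen_interior.inter isOpen_interior) ⟨hx, hx'⟩⟩
  rw [interior_convexHull_nonempty_iff_affineSpan_eq_top] at hne
  have hind : AffineIndependent ℝ ((↑) : (T.1 ∩ T'.1 : Finset (Pt d)) → Pt d) :=
    AffineIndependent.mono (t := ((T.1 : Finset (Pt d)) : Set (Pt d)))
      (M.indep (elt_mem_faces T)) (Finset.coe_subset.2 Finset.inter_subset_left)
  have h := hind.affineSpan_eq_top_iff_card_eq_finrank_add_one
  simp only [Subtype.range_coe_subtype, Fintype.card_coe, finrank_euclideanSpace,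
    Fintype.card_fin] at h
  have hc := h.1 hne
  have h1 : T.1 ∩ T'.1 = T.1 :=
    Finset.eq_of_subset_of_card_le Finset.inter_subset_left (by rw [hc, elt_card])
  have h2 : T.1 ∩ T'.1 = T'.1 :=
    Finset.eq_of_subset_of_card_le Finset.inter_subset_right (by rw [hc, elt_card])
  exact Subtype.ext (h1.symm.trans h2)

lemma glue_eq {V : Type*} [AddCommGroup V] (v : M.Elt → Pt d → V) {T : M.Elt} {x : Pt d}
    (hx : x ∈ interior (cell T.1)) : glue v x = v T x := by
  rw [glue, Finset.sum_eq_single T]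
  · exact Set.indicator_of_mem hx _
  · intro T' _ hne
    exact Set.indicator_of_notMem (fun h => hne (interior_cell_disjoint h hx)) _
  · simp

lemma continuous_eval (p : MvPolynomial (Fin d) ℝ) :
    Continuous fun x : Pt d => MvPolynomial.eval x.ofLp p :=
  (MvPolynomial.continuous_eval p).comp (PiLp.continuous_ofLp 2 _)

lemma isCompact_cell (s : Finset (Pt d)) : IsCompact (cell s) :=
  s.finite_toSet.isCompact_convexHull ℝ

lemma glue_evalMat_apply {k : ℕ} (τ : M.BrokenPoly k (Fin d × Fin d)) (x : Pt d) (i j : Fin d) :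
    glue (evalMat τ) x i j = ∑ T : M.Elt, (interior (cell T.1)).indicator
      (fun x => MvPolynomial.eval x.ofLp (τ T (i, j) : MvPolynomial (Fin d) ℝ)) x := by
  classical
  rw [glue, Matrix.sum_apply]
  refine Finset.sum_congr rfl fun T _ => ?_
  by_cases h : x ∈ interior (cell T.1) <;> simp [h, evalMat]

lemma measurable_glue {k : ℕ} (τ : M.BrokenPoly k (Fin d × Fin d)) (i j : Fin d) :
    Measurable fun x => glue (evalMat τ) x i j := by
  simp_rw [glue_evalMat_apply]
  exact Finset.measurable_sum _ fun T _ =>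
    (continuous_eval _).measurable.indicator isOpen_interior.measurableSet

lemma bounded_glue {k : ℕ} (τ : M.BrokenPoly k (Fin d × Fin d)) (i j : Fin d) :
    ∃ C : ℝ, ∀ x, |glue (evalMat τ) x i j| ≤ C := by
  have h : ∀ T : M.Elt, ∃ C : ℝ, 0 ≤ C ∧ ∀ x ∈ cell T.1,
      |MvPolynomial.eval x.ofLp (τ T (i, j) : MvPolynomial (Fin d) ℝ)| ≤ C := fun T => by
    obtain ⟨C, hC⟩ := (isCompact_cell T.1).exists_bound_of_continuousOn
      (continuous_eval (τ T (i, j) : MvPolynomial (Fin d) ℝ)).continuousOn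
    exact ⟨max C 0, le_max_right _ _, fun x hx => (hC x hx).trans (le_max_left _ _)⟩
  choose C hC0 hC using h
  refine ⟨∑ T, C T, fun x => ?_⟩
  rw [glue_evalMat_apply]
  refine (Finset.abs_sum_le_sum_abs _ _).trans (Finset.sum_le_sum fun T _ => ?_)
  by_cases hx : x ∈ interior (cell T.1)
  · rw [Set.indicator_of_mem hx]
    exact hC T x (interior_subset hx)
  · rw [Set.indicator_of_notMem hx, abs_zero]
    exact hC0 T

lemma integrable_frobProd (hΩ : IsPolytopalDomain Ω) {k : ℕ}
    (σ τ : M.BrokenPoly k (Fin d × Fin d)) :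
    Integrable (fun x => frobProd (glue (evalMat σ) x) (glue (evalMat τ) x))
      (volume.restrict Ω) := by
  have : IsFiniteMeasure (volume.restrict Ω) := ⟨by
    simpa using hΩ.isBounded.measure_lt_top⟩
  unfold frobProd
  refine integrable_finsetSum _ fun i _ => integrable_finsetSum _ fun j _ => ?_
  obtain ⟨C, hC⟩ := bounded_glue σ i j
  obtain ⟨D, hD⟩ := bounded_glue τ i j
  refine Integrable.of_bound ((measurable_glue σ i j).mul
    (measurable_glue τ i j)).aestronglyMeasurable (C * D) (Filter.Eventually.of_forall fun x => ?_)
  rw [Real.norm_eq_abs, abs_mul]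
  exact mul_le_mul (hC x) (hD x) (abs_nonneg _) ((abs_nonneg _).trans (hC x))

lemma evalMat_add {k : ℕ} (σ τ : M.BrokenPoly k (Fin d × Fin d)) :
    evalMat (σ + τ) = evalMat σ + evalMat τ := by
  ext T x i j; simp [evalMat]

lemma evalMat_smul {k : ℕ} (c : ℝ) (τ : M.BrokenPoly k (Fin d × Fin d)) :
    evalMat (c • τ) = c • evalMat τ := by
  ext T x i j; simp [evalMat]

lemma glue_add {V : Type*} [AddCommGroup V] (u v : M.Elt → Pt d → V) (x : Pt d) :
    glue (u + v) x = glue u x + glue v x := by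
  simp only [glue, ← Finset.sum_add_distrib]
  refine Finset.sum_congr rfl fun T _ => ?_
  by_cases h : x ∈ interior (cell T.1) <;> simp [h]

lemma glue_smul {V : Type*} [AddCommGroup V] [Module ℝ V] (c : ℝ) (v : M.Elt → Pt d → V)
    (x : Pt d) : glue (c • v) x = c • glue v x := by
  simp only [glue, Finset.smul_sum]
  refine Finset.sum_congr rfl fun T _ => ?_
  by_cases h : x ∈ interior (cell T.1) <;> simp [h]

/-- A polynomial vanishing on a nonempty open set is zero. -/
lemma poly_eq_zero {U : Set (Pt d)} (hU : IsOpen U) (hne : U.Nonempty)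
    (p : MvPolynomial (Fin d) ℝ) (h : ∀ x ∈ U, MvPolynomial.eval x.ofLp p = 0) : p = 0 := by
  obtain ⟨x, hx⟩ := hne
  have hU' : IsOpen ((WithLp.toLp 2 : (Fin d → ℝ) → Pt d) ⁻¹' U) :=
    hU.preimage (PiLp.continuous_toLp 2 _)
  obtain ⟨ε, hε, hb⟩ := Metric.isOpen_iff.1 hU' x.ofLp (by simpa using hx)
  refine MvPolynomial.funext_set (fun i => Metric.ball (x.ofLp i) ε) (fun i => ?_) fun y hy => ?_
  · rw [Real.ball_eq_Ioo]
    exact Set.Ioo_infinite (by linarith)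
  · rw [← ball_pi _ hε] at hy
    simpa using h _ (hb hy)

/-- The `L²(Ω)` product of broken tensor polynomials. -/
def l2Form (hΩ : IsPolytopalDomain Ω) (k : ℕ) :
    M.BrokenPoly k (Fin d × Fin d) →ₗ[ℝ] M.BrokenPoly k (Fin d × Fin d) →ₗ[ℝ] ℝ :=
  LinearMap.mk₂ ℝ
    (fun σ τ => ∫ x in Ω, frobProd (glue (evalMat σ) x) (glue (evalMat τ) x))
    (fun σ σ' τ => by
      rw [← integral_add (integrable_frobProd hΩ σ τ) (integrable_frobProd hΩ σ' τ)]
      congr 1; ext x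
      simp [frobProd, evalMat_add, glue_add, add_mul, Finset.sum_add_distrib])
    (fun c σ τ => by
      rw [smul_eq_mul, ← integral_const_mul]
      congr 1; ext x
      simp [frobProd, evalMat_smul, glue_smul, Finset.mul_sum, mul_assoc])
    (fun σ τ τ' => by
      rw [← integral_add (integrable_frobProd hΩ σ τ) (integrable_frobProd hΩ σ τ')]
      congr 1; ext x
      simp [frobProd, evalMat_add, glue_add, mul_add, Finset.sum_add_distrib])
    (fun c σ τ => by
      rw [smul_eq_mul, ← integral_const_mul]
      congr 1; ext x
      simp [frobProd, evalMat_smul, glue_smul, Finset.mul_sum, mul_left_comm])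

lemma l2Form_definite (hΩ : IsPolytopalDomain Ω) {k : ℕ} (r : M.BrokenPoly k (Fin d × Fin d))
    (h : ∫ x in Ω, frobProd (glue (evalMat r) x) (glue (evalMat r) x) = 0) : r = 0 := by
  have hnn : ∀ A : Matrix (Fin d) (Fin d) ℝ, 0 ≤ frobProd A A := fun A =>
    Finset.sum_nonneg fun i _ => Finset.sum_nonneg fun j _ => mul_self_nonneg _
  have hae := (integral_eq_zero_iff_of_nonneg (fun x => hnn _) (integrable_frobProd hΩ r r)).1 h
  ext T ⟨i, j⟩ : 2
  apply Subtype.ext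
  refine poly_eq_zero isOpen_interior (interior_cell_nonempty T) _ ?_
  have hae' : (fun x : Pt d => MvPolynomial.eval x.ofLp (r T (i, j) : MvPolynomial (Fin d) ℝ))
      =ᵐ[volume.restrict (interior (cell T.1))] fun _ => 0 := by
    have h1 := ae_restrict_of_ae_restrict_of_subset (interior_cell_subset hΩ T) hae
    filter_upwards [h1, ae_restrict_mem isOpen_interior.measurableSet] with x hx hxT
    rw [glue_eq _ hxT] at hx
    have h2 := (Finset.sum_eq_zero_iff_of_nonneg (fun i _ =>
      Finset.sum_nonneg fun j _ => mul_self_nonneg _)).1 hx i (Finset.mem_univ _)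
    have h3 := (Finset.sum_eq_zero_iff_of_nonneg (fun j _ => mul_self_nonneg _)).1 h2 j
      (Finset.mem_univ _)
    simpa [evalMat] using h3
  exact Measure.eqOn_open_of_ae_eq hae' isOpen_interior (continuous_eval _).continuousOn
    continuousOn_const

lemma avg_add {V : Type*} [AddCommGroup V] [Module ℝ V] (F : Finset (Pt d))
    (u v : M.Elt → Pt d → V) (x : Pt d) : avg F (u + v) x = avg F u x + avg F v x := by
  simp [avg, Finset.sum_add_distrib]

lemma avg_smul {V : Type*} [AddCommGroup V] [Module ℝ V] (F : Finset (Pt d)) (c : ℝ)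
    (v : M.Elt → Pt d → V) (x : Pt d) : avg F (c • v) x = c • avg F v x := by
  simp [avg, ← Finset.smul_sum, smul_comm c]

lemma integrable_face (n : M.FaceNormals) (F : Finset (Pt d)) (w : Pt d → Pt d)
    (hw : IntegrableOn w (cell F) μHE[d - 1]) {k : ℕ} (τ : M.BrokenPoly k (Fin d × Fin d)) :
    IntegrableOn (fun x => inner ℝ (w x)
        (WithLp.toLp 2 ((avg F (evalMat τ) x).mulVec (n.normal F).ofLp) : Pt d))
      (cell F) μHE[d - 1] := by
  have hm : Continuous fun x => avg F (evalMat τ) x := by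
    unfold avg
    have h : Continuous fun x => ∑ T ∈ M.elementsOf F, evalMat τ T x :=
      continuous_finsetSum _ fun T _ => continuous_matrix fun i j => continuous_eval _
    exact h.const_smul (((M.elementsOf F).card : ℝ)⁻¹)
  have hc : Continuous fun x =>
      (WithLp.toLp 2 ((avg F (evalMat τ) x).mulVec (n.normal F).ofLp) : Pt d) :=
    (PiLp.continuous_toLp 2 _).comp (hm.matrix_mulVec continuous_const)
  obtain ⟨C, hC⟩ := (isCompact_cell F).exists_bound_of_continuousOn hc.continuousOn
  refine Integrable.mono' (hw.norm.mul_const C)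
    (hw.aestronglyMeasurable.inner hc.aestronglyMeasurable) ?_
  filter_upwards [ae_restrict_mem (isCompact_cell F).measurableSet] with x hx
  exact (norm_inner_le_norm _ _).trans
    (mul_le_mul_of_nonneg_left (hC x hx) (norm_nonneg _))

/-- For integrable `w`, the local lifting equation has exactly one solution. -/
theorem existsUnique_isFaceLifting (hΩ : IsPolytopalDomain Ω) (k : ℕ) (n : M.FaceNormals)
    (F : Finset (Pt d)) (w : Pt d → Pt d) (hw : IntegrableOn w (cell F) μHE[d - 1]) :
    ∃! r : M.BrokenPoly k (Fin d × Fin d), IsFaceLifting n F w r := by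
  let L : M.BrokenPoly k (Fin d × Fin d) →ₗ[ℝ] ℝ :=
    { toFun := fun τ => ∫ x in cell F, inner ℝ (w x)
        (WithLp.toLp 2 ((avg F (evalMat τ) x).mulVec (n.normal F).ofLp) : Pt d) ∂μHE[d - 1]
      map_add' := fun σ τ => by
        rw [← integral_add (integrable_face n F w hw σ) (integrable_face n F w hw τ)]
        congr 1; ext x
        rw [evalMat_add, avg_add, Matrix.add_mulVec, WithLp.toLp_add, inner_add_right]
      map_smul' := fun c τ => by
        rw [RingHom.id_apply, smul_eq_mul, ← integral_const_mul]
        congr 1; ext x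
        rw [evalMat_smul, avg_smul, Matrix.smul_mulVec, WithLp.toLp_smul, inner_smul_right] }
  have hinj : Function.Injective (l2Form (M := M) hΩ k) := by
    rw [← LinearMap.ker_eq_bot, LinearMap.ker_eq_bot']
    intro r hr
    exact l2Form_definite hΩ r (by simpa [l2Form] using LinearMap.congr_fun hr r)
  have hsurj : Function.Surjective (l2Form (M := M) hΩ k) :=
    (LinearMap.injective_iff_surjective_of_finrank_eq_finrank
      (Subspace.dual_finrank_eq (K := ℝ) (V := M.BrokenPoly k (Fin d × Fin d))).symm).1 hinj
  obtain ⟨r, hr⟩ := hsurj L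
  refine ⟨r, fun τ => LinearMap.congr_fun hr τ, fun r' hr' => hinj ?_⟩
  rw [hr]
  exact LinearMap.ext fun τ => hr' τ

theorem isFaceLifting_faceLifting (hΩ : IsPolytopalDomain Ω) (k : ℕ) (n : M.FaceNormals)
    (F : Finset (Pt d)) (w : Pt d → Pt d) (hw : IntegrableOn w (cell F) μHE[d - 1]) :
    IsFaceLifting n F w (faceLifting k n F w) := by
  have h := (existsUnique_isFaceLifting hΩ k n F w hw).exists
  rw [faceLifting, dif_pos h]
  exact h.choose_spec

end SimplicialMesh

end HdivDG

end

/-!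
Both inequalities hold element by element. On an element `T`, testing the definition of
the lifting with tensors supported in `T` shows that `R = R_h^k v` restricted to `T` satisfies
`∫_T R : τ = ∑_{F ⊂ T} κ_F ∫_F [v] · (τ n_F)` for all polynomial tensors `τ` of degree `k` on `T`,
where `κ_F` is the inverse of the number of elements sharing `F`, hence `1` or `1/2`
(`SimplicialMesh.isElementLifting_jumpLifting`, `SimplicialMesh.card_elementsOf_le_two`).

* Upper bound (`exists_norm_lifting_le`): take `τ = R`.
* Lower bound (`exists_norm_face_le`): for a face `F` of `T`, opposite to the vertex `a`, take a `τ`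
  with `τ n_F = [v]` on `F` and `τ n_{F'} = 0` on the other faces `F'` of `T`. As `k ≥ 1`, every
  polynomial on `F` is a combination of products `λ_{s 0} ⋯ λ_{s (k-1)}` of barycentric coordinates
  of vertices of `F`; multiplying such a product by the edge from `a` to the vertex of `λ_{s 0}`,
  divided by the height of `T` over `F`, gives the required normal components (`testTensor`).

The constants come from two facts. On a finite-dimensional space of polynomials over the reference
simplex, the `L^q` norms control suitably chosen coefficients (`exists_bern_bound`). And on a
shape-regular simplex of size `h` the affine parametrizations of the element and of its faces by
reference simplices are bi-Lipschitz with constants proportional to `h` and `h⁻¹`, because the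
barycentric coordinates vary by at most `1` on the inscribed ball (`abs_coord_sub_le`), so
that they distort the `n`-dimensional Hausdorff measure by a factor comparable to `h ^ n`.
-/

noncomputable section

namespace HdivDG

/-! ### Polynomial functions and the reference simplex -/

section Reference

variable {m d k : ℕ} {E : Type*} [NormedAddCommGroup E] [NormedSpace ℝ E]

/-- `E`-valued polynomial functions of degree at most `k` on `ℝ^d`, as the span of the products
of `k` affine functions with a vector. -/
def polyFun (d k : ℕ) (E : Type*) [NormedAddCommGroup E] [NormedSpace ℝ E] :
    Submodule ℝ (Pt d → E) :=
  Submodule.span ℝ {f | ∃ (l : Fin k → Pt d →ᵃ[ℝ] ℝ) (e : E), f = fun x => (∏ j, l j x) • e}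

/-- The barycentric coordinates of the reference simplex with vertices `0, e₁, …, e_m`. -/
def refCoord (m : ℕ) (i : Fin (m + 1)) (x : Pt m) : ℝ :=
  Fin.cases (1 - ∑ j, x j) (fun j => x j) i

@[simp] lemma refCoord_zero (x : Pt m) : refCoord m 0 x = 1 - ∑ j, x j := rfl

@[simp] lemma refCoord_succ (x : Pt m) (j : Fin m) : refCoord m j.succ x = x j := rfl

lemma sum_refCoord (x : Pt m) : ∑ i, refCoord m i x = 1 := by
  simp [Fin.sum_univ_succ]

lemma continuous_refCoord (i : Fin (m + 1)) : Continuous (refCoord m i) := by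
  refine Fin.cases ?_ (fun j => ?_) i
  · rw [funext (refCoord_zero (m := m))]
    fun_prop
  · rw [funext (fun x => refCoord_succ (m := m) x j)]
    fun_prop

/-- The closed reference simplex in `ℝ^m`. -/
def refSimplex (m : ℕ) : Set (Pt m) := {x | ∀ i, 0 ≤ refCoord m i x}

/-- The affine parametrization, by the reference simplex, of the simplex with vertices `a`. -/
def simplexMap (a : Fin (m + 1) → Pt d) (x : Pt m) : Pt d := ∑ i, refCoord m i x • a i

lemma continuous_simplexMap (a : Fin (m + 1) → Pt d) : Continuous (simplexMap a) :=
  continuous_finsetSum _ fun i _ => (continuous_refCoord i).smul continuous_const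

lemma refCoord_le_one {x : Pt m} (hx : x ∈ refSimplex m) (i : Fin (m + 1)) :
    refCoord m i x ≤ 1 := by
  rw [← sum_refCoord x]
  exact Finset.single_le_sum (f := fun i => refCoord m i x) (fun i _ => hx i) (Finset.mem_univ i)

lemma isCompact_refSimplex (m : ℕ) : IsCompact (refSimplex m) := by
  have hcl : IsClosed (refSimplex m) := by
    rw [refSimplex, Set.ofPred_forall]
    exact isClosed_iInter fun i => isClosed_le continuous_const (continuous_refCoord i)
  have hK : IsCompact ((WithLp.toLp 2 : (Fin m → ℝ) → Pt m) ''
      Set.univ.pi fun _ => Set.Icc (0 : ℝ) 1) :=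
    (isCompact_univ_pi fun _ => isCompact_Icc).image (PiLp.continuous_toLp 2 _)
  refine hK.of_isClosed_subset hcl fun x hx => ⟨x.ofLp, fun j _ => ⟨?_, ?_⟩, by simp⟩
  · exact hx j.succ
  · exact refCoord_le_one hx j.succ

lemma refCoord_convexComb {a b : ℝ} (hab : a + b = 1) (x y : Pt m) (i : Fin (m + 1)) :
    refCoord m i (a • x + b • y) = a * refCoord m i x + b * refCoord m i y := by
  refine Fin.cases ?_ (fun j => ?_) i
  · simp only [refCoord_zero, PiLp.add_apply, PiLp.smul_apply, smul_eq_mul,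
      Finset.sum_add_distrib, ← Finset.mul_sum]
    linear_combination -hab
  · simp

lemma convex_refSimplex (m : ℕ) : Convex ℝ (refSimplex m) := by
  intro x hx y hy a b ha hb hab i
  rw [refCoord_convexComb hab]
  exact add_nonneg (mul_nonneg ha (hx i)) (mul_nonneg hb (hy i))

lemma interior_refSimplex_nonempty (m : ℕ) : (interior (refSimplex m)).Nonempty := by
  have ho : IsOpen {x : Pt m | ∀ i, 0 < refCoord m i x} := by
    rw [Set.ofPred_forall]
    exact isOpen_iInter_of_finite fun i => isOpen_lt continuous_const (continuous_refCoord i)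
  refine ⟨WithLp.toLp 2 fun _ => 1 / ((m : ℝ) + 1),
    interior_maximal (fun x hx i => (hx i).le) ho fun i => ?_⟩
  refine Fin.cases ?_ (fun j => ?_) i
  · have : (m : ℝ) + 1 ≠ 0 := by positivity
    have h1 : 1 - (m : ℝ) * (1 / (m + 1)) = 1 / (m + 1) := by field_simp; ring
    simp only [refCoord_zero, Finset.sum_const, Finset.card_univ, Fintype.card_fin, nsmul_eq_mul,
      h1]
    positivity
  · simp only [refCoord_succ]
    positivity

lemma image_simplexMap (a : Fin (m + 1) → Pt d) :
    simplexMap a '' refSimplex m = convexHull ℝ (Set.range a) := by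
  apply subset_antisymm
  · rintro _ ⟨x, hx, rfl⟩
    exact (convex_convexHull ℝ _).sum_mem (fun i _ => hx i) (sum_refCoord x)
      fun i _ => subset_convexHull ℝ _ ⟨i, rfl⟩
  · refine convexHull_min ?_ ?_
    · rintro _ ⟨i, rfl⟩
      refine ⟨WithLp.toLp 2 fun j => if j.succ = i then 1 else 0, fun l => ?_, ?_⟩
      all_goals
        have key : ∀ l, refCoord m l (WithLp.toLp 2 fun j => if j.succ = i then (1 : ℝ) else 0) =
            if l = i then 1 else 0 := by
          intro l
          refine Fin.cases ?_ (fun j => ?_) l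
          · rw [refCoord_zero]
            refine Fin.cases ?_ (fun j' => ?_) i
            · simp [Fin.succ_ne_zero]
            · simp [Fin.succ_inj, (Fin.succ_ne_zero _).symm]
          · simp
      · rw [key]; split_ifs <;> norm_num
      · simp [simplexMap, key]
    · rintro _ ⟨x, hx, rfl⟩ _ ⟨y, hy, rfl⟩ s t hs ht hst
      refine ⟨s • x + t • y, convex_refSimplex m hx hy hs ht hst, ?_⟩
      simp only [simplexMap, refCoord_convexComb hst, Finset.smul_sum, add_smul, mul_smul,
        Finset.sum_add_distrib]

/-- The polynomial on the reference simplex with (redundant) Bernstein coefficients `c`. The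
indexing by all functions `Fin k → Fin (m + 1)` instead of multi-indices makes products of affine
functions expand directly. -/
def bern (c : (Fin k → Fin (m + 1)) → E) (x : Pt m) : E :=
  ∑ s, (∏ j, refCoord m (s j) x) • c s

lemma continuous_bern_uncurry :
    Continuous fun p : ((Fin k → Fin (m + 1)) → E) × Pt m => bern p.1 p.2 :=
  continuous_finsetSum _ fun s _ => (continuous_finsetProd _ fun j _ =>
    (continuous_refCoord (s j)).comp continuous_snd).smul
      ((continuous_apply s).comp continuous_fst)

lemma continuous_bern (c : (Fin k → Fin (m + 1)) → E) : Continuous (bern c) :=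
  continuous_finsetSum _ fun s _ => (continuous_finsetProd _ fun j _ =>
    continuous_refCoord (s j)).smul continuous_const

lemma bern_add (c c' : (Fin k → Fin (m + 1)) → E) (x : Pt m) :
    bern (c + c') x = bern c x + bern c' x := by
  simp [bern, Finset.sum_add_distrib]

lemma bern_smul (t : ℝ) (c : (Fin k → Fin (m + 1)) → E) (x : Pt m) :
    bern (t • c) x = t • bern c x := by
  simp [bern, Finset.smul_sum, smul_comm t]

lemma norm_bern_le (c : (Fin k → Fin (m + 1)) → E) {x : Pt m} (hx : x ∈ refSimplex m) :
    ‖bern c x‖ ≤ ((m : ℝ) + 1) ^ k * ‖c‖ := by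
  have h1 : ∀ s : Fin k → Fin (m + 1), ‖(∏ j, refCoord m (s j) x) • c s‖ ≤ ‖c‖ := fun s => by
    rw [norm_smul, Real.norm_eq_abs, abs_of_nonneg (Finset.prod_nonneg fun j _ => hx _)]
    exact (mul_le_of_le_one_left (norm_nonneg _) (Finset.prod_le_one (fun j _ => hx _)
      fun j _ => refCoord_le_one hx _)).trans (norm_le_pi_norm c s)
  refine (norm_sum_le_of_le _ fun s _ => h1 s).trans (le_of_eq ?_)
  simp

lemma affine_simplexMap (l : Pt d →ᵃ[ℝ] ℝ) (a : Fin (m + 1) → Pt d) (x : Pt m) :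
    l (simplexMap a x) = ∑ i, refCoord m i x * l (a i) := by
  have h : ∀ y, l y = l.linear y + l 0 := fun y => by
    simpa using l.map_vadd 0 y
  rw [h (simplexMap a x), simplexMap, map_sum]
  simp_rw [h (a _), mul_add, Finset.sum_add_distrib, ← Finset.sum_mul, sum_refCoord, one_mul,
    map_smul, smul_eq_mul]

/-- Every polynomial of degree at most `k` has a Bernstein representation on every simplex. -/
lemma exists_bern_eq {f : Pt d → E} (hf : f ∈ polyFun d k E) (a : Fin (m + 1) → Pt d) :
    ∃ c : (Fin k → Fin (m + 1)) → E, ∀ x, f (simplexMap a x) = bern c x := by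
  induction hf using Submodule.span_induction with
  | mem f hf =>
    obtain ⟨l, e, rfl⟩ := hf
    refine ⟨fun s => (∏ j, l j (a (s j))) • e, fun x => ?_⟩
    simp only [affine_simplexMap, bern, smul_smul, ← Finset.sum_smul, ← Finset.prod_mul_distrib]
    rw [Finset.prod_univ_sum, Fintype.piFinset_univ]
  | zero => exact ⟨0, fun x => by simp [bern]⟩
  | add f g _ _ hf hg =>
    obtain ⟨c, hc⟩ := hf
    obtain ⟨c', hc'⟩ := hg
    exact ⟨c + c', fun x => by rw [bern_add, ← hc, ← hc']; rfl⟩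
  | smul t f _ hf =>
    obtain ⟨c, hc⟩ := hf
    exact ⟨t • c, fun x => by rw [bern_smul, ← hc]; rfl⟩

lemma continuous_of_mem_polyFun {f : Pt d → E} (hf : f ∈ polyFun d k E) : Continuous f := by
  induction hf using Submodule.span_induction with
  | mem f hf =>
    obtain ⟨l, e, rfl⟩ := hf
    exact (continuous_finsetProd _ fun j _ => (l j).continuous_of_finiteDimensional).smul
      continuous_const
  | zero => exact continuous_const
  | add f g _ _ hf hg => exact hf.add hg
  | smul t f _ hf => exact hf.const_smul t

/-- The coefficients of a polynomial can be chosen, simultaneously for all `q`, so that they are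
bounded by its `L^q` norm on the reference simplex: on a complement of the coefficients of the zero
polynomial, the `L^q` norm is positive on the compact unit sphere. -/
lemma exists_bern_bound (m k : ℕ) (E : Type*) [NormedAddCommGroup E] [NormedSpace ℝ E]
    [FiniteDimensional ℝ E] :
    ∃ g : ((Fin k → Fin (m + 1)) → E) → ((Fin k → Fin (m + 1)) → E),
      (∀ c, ∀ x ∈ refSimplex m, bern (g c) x = bern c x) ∧
      ∀ q : ℝ, 1 ≤ q → ∃ C : ℝ, 0 < C ∧
        ∀ c, ‖g c‖ ^ q ≤ C * ∫ x in refSimplex m, ‖bern c x‖ ^ q := by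
  let N : Submodule ℝ ((Fin k → Fin (m + 1)) → E) :=
    { carrier := {c | ∀ x ∈ refSimplex m, bern c x = 0}
      add_mem' := fun {a b} ha hb x hx => by rw [bern_add, ha x hx, hb x hx, add_zero]
      zero_mem' := fun x _ => by simp only [bern, Pi.zero_apply, smul_zero, Finset.sum_const_zero]
      smul_mem' := fun t c hc x hx => by rw [bern_smul, hc x hx, smul_zero] }
  obtain ⟨W, hW⟩ := N.exists_isCompl
  have hdec : ∀ c : (Fin k → Fin (m + 1)) → E, ∃ w ∈ W,
      ∀ x ∈ refSimplex m, bern w x = bern c x := fun c => by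
    obtain ⟨y, hy, w, hw, hyw⟩ := Submodule.mem_sup.1
      (hW.sup_eq_top.ge (Submodule.mem_top : c ∈ ⊤))
    exact ⟨w, hw, fun x hx => by rw [← hyw, bern_add, hy x hx, zero_add]⟩
  choose g hgW hg using hdec
  -- `g` is the projection to the complement, which does not depend on `q`.
  refine ⟨g, hg, fun q hq => ?_⟩
  have hq0 : 0 ≤ q := by linarith
  let f : ((Fin k → Fin (m + 1)) → E) → ℝ := fun c => ∫ x in refSimplex m, ‖bern c x‖ ^ q
  have hmeas : MeasurableSet (refSimplex m) := (isCompact_refSimplex m).measurableSet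
  have hcont : ∀ c : (Fin k → Fin (m + 1)) → E,
      Continuous fun x : Pt m => ‖bern c x‖ ^ q := fun c =>
    (continuous_bern c).norm.rpow_const fun _ => Or.inr hq0
  have hfc : Continuous f :=
    continuous_parametric_integral_of_continuous
      (f := fun (c : (Fin k → Fin (m + 1)) → E) (x : Pt m) => ‖bern c x‖ ^ q)
      (continuous_bern_uncurry.norm.rpow_const fun _ => Or.inr hq0) (isCompact_refSimplex m)
  have hfpos : ∀ w ∈ W, w ≠ 0 → 0 < f w := by
    intro w hw hw0
    have hnn : 0 ≤ f w := integral_nonneg fun x => Real.rpow_nonneg (norm_nonneg _) _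
    refine hnn.lt_of_ne fun h0 => hw0 ?_
    have hae := (setIntegral_eq_zero_iff_of_nonneg_ae
      (Filter.Eventually.of_forall fun x => Real.rpow_nonneg (norm_nonneg _) _)
      ((hcont w).continuousOn.integrableOn_compact (isCompact_refSimplex m))).1 h0.symm
    have hae' := ae_restrict_of_ae_restrict_of_subset
      (interior_subset : interior (refSimplex m) ⊆ _) hae
    have hEq := Measure.eqOn_open_of_ae_eq hae' isOpen_interior (hcont w).continuousOn
      continuousOn_const
    -- The interior of the simplex is dense in it, so the polynomial vanishes on all of it.
    have hEq' := hEq.closure (hcont w) continuous_const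
    rw [(convex_refSimplex m).closure_interior_eq_closure_of_nonempty_interior
      (interior_refSimplex_nonempty m)] at hEq'
    have hN : w ∈ N := fun x hx => by
      have := hEq' (subset_closure hx)
      simp only [Pi.zero_apply] at this
      rw [Real.rpow_eq_zero (norm_nonneg _) (by linarith)] at this
      exact norm_eq_zero.1 this
    exact Submodule.disjoint_def.1 hW.disjoint w hN hw
  have hK : IsCompact (Metric.sphere (0 : (Fin k → Fin (m + 1)) → E) 1 ∩ W) :=
    (isCompact_sphere _ _).inter_right W.closed_of_finiteDimensional
  obtain ⟨ε, hε, hεle⟩ : ∃ ε : ℝ, 0 < ε ∧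
      ∀ w ∈ Metric.sphere (0 : (Fin k → Fin (m + 1)) → E) 1 ∩ W, ε ≤ f w := by
    rcases (Metric.sphere (0 : (Fin k → Fin (m + 1)) → E) 1 ∩
      (W : Set ((Fin k → Fin (m + 1)) → E))).eq_empty_or_nonempty with he | hne
    · exact ⟨1, one_pos, by simp [he]⟩
    · obtain ⟨w, hw, hmin⟩ := hK.exists_isMinOn hne hfc.continuousOn
      refine ⟨f w, hfpos w hw.2 ?_, fun w' hw' => hmin hw'⟩
      rintro rfl
      simpa using hw.1
  refine ⟨ε⁻¹, inv_pos.2 hε, fun c => ?_⟩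
  have hfg : f (g c) = ∫ x in refSimplex m, ‖bern c x‖ ^ q :=
    setIntegral_congr_fun hmeas fun x hx => by simp only [hg c x hx]
  rw [← hfg, inv_mul_eq_div, le_div_iff₀ hε]
  rcases eq_or_ne (g c) 0 with h0 | h0
  · rw [h0, norm_zero, Real.zero_rpow (by linarith), zero_mul]
    exact integral_nonneg fun x => Real.rpow_nonneg (norm_nonneg _) _
  -- Both sides are homogeneous of degree `q`.
  · have hn : 0 < ‖g c‖ := norm_pos_iff.2 h0
    have h1 := hεle (‖g c‖⁻¹ • g c) ⟨by
      simp [norm_smul, hn.ne'], W.smul_mem _ (hgW c)⟩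
    have h2 : f (‖g c‖⁻¹ • g c) = (‖g c‖ ^ q)⁻¹ * f (g c) := by
      simp only [f]
      rw [← integral_const_mul]
      congr 1; ext x
      rw [bern_smul, norm_smul, norm_inv, norm_norm, Real.mul_rpow (by positivity) (norm_nonneg _),
        Real.inv_rpow hn.le]
    rw [h2, inv_mul_eq_div, le_div_iff₀ (Real.rpow_pos_of_pos hn q)] at h1
    linarith

end Reference

/-! ### Change of variables inequalities for the surface measure -/

section Measure

open scoped NNReal ENNReal

variable {m d k : ℕ} {E : Type*} [NormedAddCommGroup E] [NormedSpace ℝ E]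

/-- The volume on `ℝ^m` is its `m`-dimensional Hausdorff measure, so Lipschitz bounds apply. -/
lemma measure_image_le_of_lipschitz {f : Pt m → Pt d} {K : ℝ≥0} (hf : LipschitzWith K f)
    (s : Set (Pt m)) : μHE[m] (f '' s) ≤ (K : ℝ≥0∞) ^ m * volume s := by
  rw [← EuclideanSpace.euclideanHausdorffMeasure_eq_volume,
    Measure.euclideanHausdorffMeasure_def, Measure.euclideanHausdorffMeasure_def,
    Measure.smul_apply, Measure.smul_apply, ENNReal.smul_def, ENNReal.smul_def, smul_eq_mul,
    smul_eq_mul, mul_left_comm]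
  gcongr
  simpa using hf.hausdorffMeasure_image_le (Nat.cast_nonneg m) s

lemma measure_le_of_antilipschitz {f : Pt m → Pt d} {K : ℝ≥0} (hf : AntilipschitzWith K f)
    (s : Set (Pt m)) : volume s ≤ (K : ℝ≥0∞) ^ m * μHE[m] (f '' s) := by
  rw [← EuclideanSpace.euclideanHausdorffMeasure_eq_volume,
    Measure.euclideanHausdorffMeasure_def, Measure.euclideanHausdorffMeasure_def,
    Measure.smul_apply, Measure.smul_apply, ENNReal.smul_def, ENNReal.smul_def, smul_eq_mul,
    smul_eq_mul, mul_left_comm]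
  gcongr
  simpa using hf.le_hausdorffMeasure_image (Nat.cast_nonneg m) s

variable {a : Fin (m + 1) → Pt d} {K : ℝ≥0}

lemma isCompact_convexHull_range (a : Fin (m + 1) → Pt d) :
    IsCompact (convexHull ℝ (Set.range a)) :=
  (Set.finite_range a).isCompact_convexHull ℝ

lemma measure_convexHull_le (ha : LipschitzWith K (simplexMap a)) :
    μHE[m] (convexHull ℝ (Set.range a)) ≤ (K : ℝ≥0∞) ^ m * volume (refSimplex m) := by
  rw [← image_simplexMap]
  exact measure_image_le_of_lipschitz ha _

lemma measure_convexHull_lt_top (ha : LipschitzWith K (simplexMap a)) :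
    μHE[m] (convexHull ℝ (Set.range a)) < ∞ :=
  (measure_convexHull_le ha).trans_lt (ENNReal.mul_lt_top (by simp)
    (isCompact_refSimplex m).measure_lt_top)

lemma norm_setIntegral_convexHull_le (ha : LipschitzWith K (simplexMap a)) {g : Pt d → ℝ} {S : ℝ}
    (hS : 0 ≤ S) (hg : ∀ x ∈ refSimplex m, ‖g (simplexMap a x)‖ ≤ S) :
    ‖∫ x in convexHull ℝ (Set.range a), g x ∂μHE[m]‖ ≤
      S * (K ^ m * volume.real (refSimplex m)) := by
  refine (norm_setIntegral_le_of_norm_le_const (measure_convexHull_lt_top ha) (C := S)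
    fun x hx => ?_).trans (mul_le_mul_of_nonneg_left ?_ hS)
  · rw [← image_simplexMap] at hx
    obtain ⟨y, hy, rfl⟩ := hx
    exact hg y hy
  · have h := ENNReal.toReal_mono (ENNReal.mul_ne_top (by simp)
      (isCompact_refSimplex m).measure_lt_top.ne) (measure_convexHull_le ha)
    simpa [Measure.real] using h

lemma integrableOn_convexHull (ha : LipschitzWith K (simplexMap a)) {F : Type*}
    [NormedAddCommGroup F] {g : Pt d → F} (hg : Continuous g) :
    IntegrableOn g (convexHull ℝ (Set.range a)) μHE[m] := by
  obtain ⟨C, hC⟩ := (isCompact_convexHull_range a).exists_bound_of_continuousOn hg.continuousOn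
  refine IntegrableOn.of_bound (measure_convexHull_lt_top ha) ?_ C ?_
  · exact hg.continuousOn.aestronglyMeasurable_of_isCompact (isCompact_convexHull_range a)
      (isCompact_convexHull_range a).measurableSet
  · filter_upwards [ae_restrict_mem (isCompact_convexHull_range a).measurableSet] with x hx
    exact hC x hx

lemma setIntegral_refSimplex_le {K' : ℝ≥0} (ha' : LipschitzWith K' (simplexMap a))
    (ha : AntilipschitzWith K (simplexMap a))
    {g : Pt d → ℝ} (hg : Continuous g) (hg0 : ∀ x, 0 ≤ g x) :
    ∫ x in refSimplex m, g (simplexMap a x) ≤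
      K ^ m * ∫ x in convexHull ℝ (Set.range a), g x ∂μHE[m] := by
  have hφ : Measurable (simplexMap a) := (continuous_simplexMap a).measurable
  have hle : (volume.restrict (refSimplex m)).map (simplexMap a) ≤
      ((K : ℝ≥0) ^ m : ℝ≥0) • (μHE[m] : Measure (Pt d)).restrict (convexHull ℝ (Set.range a)) := by
    refine Measure.le_iff.2 fun s hs => ?_
    rw [Measure.map_apply hφ hs, Measure.restrict_apply (hφ hs), Measure.smul_apply,
      Measure.restrict_apply hs, ENNReal.smul_def, smul_eq_mul]
    refine (measure_le_of_antilipschitz ha _).trans ?_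
    push_cast
    gcongr
    rw [← image_simplexMap]
    rintro _ ⟨x, hx, rfl⟩
    exact ⟨hx.1, x, hx.2, rfl⟩
  have h1 := integral_mono_measure hle (Filter.Eventually.of_forall hg0)
    ((integrableOn_convexHull ha' hg).smul_measure_nnreal)
  rw [integral_map hφ.aemeasurable hg.aestronglyMeasurable, integral_smul_nnreal_measure] at h1
  simpa [NNReal.smul_def] using h1

end Measure

/-! ### Shape-regular simplices -/

section Geometry

open scoped NNReal ENNReal RealInnerProductSpace

variable {d n : ℕ} {B : AffineBasis (Fin (d + 1)) ℝ (Pt d)} {A h : ℝ}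

/-- The simplex with vertices `B` has size `h` up to the constant `A`: its edges have length at
most `h`, and its barycentric coordinates are Lipschitz with constant `A / h`. -/
structure ShapeRegular (B : AffineBasis (Fin (d + 1)) ℝ (Pt d)) (A h : ℝ) : Prop where
  pos : 0 < h
  dist_le : ∀ i j, dist (B i) (B j) ≤ h
  coord_le : ∀ i x y, |B.coord i x - B.coord i y| ≤ A / h * ‖x - y‖

lemma coord_mem_Icc {x : Pt d} (hx : x ∈ convexHull ℝ (Set.range B)) (i : Fin (d + 1)) :
    B.coord i x ∈ Set.Icc (0 : ℝ) 1 := by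
  rw [B.convexHull_eq_nonneg_coord] at hx
  refine ⟨hx i, ?_⟩
  rw [← B.sum_coord_apply_eq_one x]
  exact Finset.single_le_sum (f := fun i => B.coord i x) (fun i _ => hx i) (Finset.mem_univ i)

/-- A simplex containing a ball has barycentric coordinates which are Lipschitz with the inverse
radius of the ball, because they vary by at most `1` on it. -/
lemma abs_coord_sub_le {x₀ : Pt d} {r : ℝ} (hr : 0 < r)
    (hb : Metric.ball x₀ r ⊆ convexHull ℝ (Set.range B)) (i : Fin (d + 1)) (x y : Pt d) :
    |B.coord i x - B.coord i y| ≤ 2 / r * ‖x - y‖ := by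
  have hlin : ∀ u v : Pt d, B.coord i u - B.coord i v = (B.coord i).linear (u - v) := fun u v => by
    simpa using ((B.coord i).linearMap_vsub u v).symm
  rw [hlin]
  rcases eq_or_ne (x - y) 0 with h0 | h0
  · simp [h0]
  set z := x - y
  have hz : 0 < ‖z‖ := norm_pos_iff.2 h0
  have hmem : x₀ + (r / (2 * ‖z‖)) • z ∈ Metric.ball x₀ r := by
    rw [mem_ball_iff_norm, add_sub_cancel_left, norm_smul, Real.norm_eq_abs,
      abs_of_pos (by positivity)]
    have : r / (2 * ‖z‖) * ‖z‖ = r / 2 := by field_simp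
    linarith
  have h1 := coord_mem_Icc (hb hmem) i
  have h2 := coord_mem_Icc (hb (Metric.mem_ball_self hr)) i
  have h3 : |B.coord i (x₀ + (r / (2 * ‖z‖)) • z) - B.coord i x₀| ≤ 1 := by
    rw [abs_le]; constructor <;> linarith [h1.1, h1.2, h2.1, h2.2]
  rw [hlin, add_sub_cancel_left, map_smul, smul_eq_mul, abs_mul, abs_of_pos (by positivity),
    div_mul_eq_mul_div, div_le_one (by positivity)] at h3
  rw [div_mul_eq_mul_div, le_div_iff₀ hr]
  linarith

lemma shapeRegular_of_ball {x₀ : Pt d} {r ϱ : ℝ} (hd : d ≠ 0) (hr : 0 < r)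
    (hb : Metric.ball x₀ r ⊆ convexHull ℝ (Set.range B))
    (hϱ : Metric.diam (convexHull ℝ (Set.range B)) ≤ ϱ * (2 * r)) :
    ShapeRegular B (4 * ϱ) (Metric.diam (convexHull ℝ (Set.range B))) := by
  have hbd : Bornology.IsBounded (convexHull ℝ (Set.range B)) :=
    ((Set.finite_range B).isCompact_convexHull ℝ).isBounded
  have hdist : ∀ i j, dist (B i) (B j) ≤ Metric.diam (convexHull ℝ (Set.range B)) := fun i j =>
    Metric.dist_le_diam_of_mem hbd (subset_convexHull ℝ _ ⟨i, rfl⟩)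
      (subset_convexHull ℝ _ ⟨j, rfl⟩)
  have hpos : 0 < Metric.diam (convexHull ℝ (Set.range B)) := by
    have hne : (0 : Fin (d + 1)) ≠ Fin.last d := by
      simpa [Fin.ext_iff] using hd.symm
    exact (dist_pos.2 fun h => hne (B.ind.injective h)).trans_le (hdist 0 (Fin.last d))
  refine ⟨hpos, hdist, fun i x y => (abs_coord_sub_le hr hb i x y).trans
    (mul_le_mul_of_nonneg_right ?_ (norm_nonneg _))⟩
  rw [div_le_div_iff₀ hr hpos]
  linarith

lemma norm_le_sum_abs (x : Pt n) : ‖x‖ ≤ ∑ j, |x j| := by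
  rw [EuclideanSpace.norm_eq]
  refine Real.sqrt_le_iff.2 ⟨Finset.sum_nonneg fun j _ => abs_nonneg _, ?_⟩
  simp only [Real.norm_eq_abs]
  exact Finset.sum_sq_le_sq_sum_of_nonneg fun j _ => abs_nonneg _

lemma abs_apply_le_norm (x : Pt n) (j : Fin n) : |x j| ≤ ‖x‖ := by
  simpa using PiLp.norm_apply_le x j

lemma lipschitzWith_simplexMap {a : Fin (n + 1) → Pt d} (hh : 0 ≤ h)
    (ha : ∀ i j, dist (a i) (a j) ≤ h) :
    LipschitzWith (n * h).toNNReal (simplexMap a) := by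
  refine LipschitzWith.of_dist_le_mul fun x y => ?_
  rw [Real.coe_toNNReal _ (by positivity), dist_eq_norm, dist_eq_norm]
  have hdiff : simplexMap a x - simplexMap a y = ∑ j : Fin n, (x - y) j • (a j.succ - a 0) := by
    simp only [simplexMap, Fin.sum_univ_succ, refCoord_zero, refCoord_succ, PiLp.sub_apply,
      sub_smul, smul_sub, Finset.sum_sub_distrib, one_smul, Finset.sum_smul]
    abel
  rw [hdiff]
  refine (norm_sum_le_of_le _ fun j _ => ?_).trans_eq (b := ∑ _j : Fin n, ‖x - y‖ * h) ?_
  · rw [norm_smul, ← dist_eq_norm (a j.succ)]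
    exact mul_le_mul (by simpa using abs_apply_le_norm (x - y) j) (ha _ _) dist_nonneg
      (norm_nonneg _)
  · simp; ring

lemma coord_simplexMap {e : Fin (n + 1) → Fin (d + 1)} (he : Function.Injective e) (x : Pt n)
    (i : Fin (n + 1)) : B.coord (e i) (simplexMap (B ∘ e) x) = refCoord n i x := by
  classical
  rw [affine_simplexMap]
  simp [B.coord_apply, he.eq_iff]

lemma coord_simplexMap_eq_zero {e : Fin (n + 1) → Fin (d + 1)} {l : Fin (d + 1)}
    (hl : ∀ i, e i ≠ l) (x : Pt n) : B.coord l (simplexMap (B ∘ e) x) = 0 := by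
  classical
  rw [affine_simplexMap]
  simp [B.coord_apply, fun i => (hl i).symm]

lemma ShapeRegular.lipschitzWith (hB : ShapeRegular B A h) (e : Fin (n + 1) → Fin (d + 1)) :
    LipschitzWith (n * h).toNNReal (simplexMap (B ∘ e)) :=
  lipschitzWith_simplexMap hB.pos.le fun _ _ => hB.dist_le _ _

lemma ShapeRegular.antilipschitzWith (hB : ShapeRegular B A h) (hA : 0 ≤ A)
    {e : Fin (n + 1) → Fin (d + 1)} (he : Function.Injective e) :
    AntilipschitzWith (n * (A / h)).toNNReal (simplexMap (B ∘ e)) := by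
  refine AntilipschitzWith.of_le_mul_dist fun x y => ?_
  have := hB.pos
  rw [Real.coe_toNNReal _ (by positivity), dist_eq_norm, dist_eq_norm]
  refine (norm_le_sum_abs _).trans ?_
  refine (Finset.sum_le_sum (g := fun _ => A / h * ‖simplexMap (B ∘ e) x - simplexMap (B ∘ e) y‖)
    fun j _ => ?_).trans_eq ?_
  · have := hB.coord_le (e j.succ) (simplexMap (B ∘ e) x) (simplexMap (B ∘ e) y)
    rwa [coord_simplexMap he, coord_simplexMap he, refCoord_succ, refCoord_succ] at this
  · simp; ring

/-- Distinct vertices have distance at least `h / A`. -/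
lemma ShapeRegular.one_le_dist (hB : ShapeRegular B A h) {i j : Fin (d + 1)} (hij : i ≠ j) :
    1 ≤ A / h * dist (B i) (B j) := by
  have := hB.coord_le i (B i) (B j)
  simpa [B.coord_apply, hij, dist_eq_norm] using this

/-- If `ν` is normal to the face opposite to the vertex `i`, the `i`-th barycentric coordinate is
the distance to that face in direction `ν`, relative to the height. -/
lemma inner_sub_vertex {ν : Pt d} {i : Fin (d + 1)}
    (hν : ∀ j j', j ≠ i → j' ≠ i → ⟪ν, B j - B j'⟫ = 0) {j : Fin (d + 1)} (hj : j ≠ i) (x : Pt d) :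
    ⟪ν, x - B j⟫ = B.coord i x * ⟪ν, B i - B j⟫ := by
  -- Expand in barycentric coordinates: all vertices but `i` contribute zero.
  have hx : x - B j = ∑ l, B.coord l x • (B l - B j) := by
    simp only [smul_sub, Finset.sum_sub_distrib, B.linear_combination_coord_eq_self,
      ← Finset.sum_smul, B.sum_coord_apply_eq_one, one_smul]
  conv_lhs => rw [hx]
  rw [inner_sum, Finset.sum_eq_single i]
  · rw [inner_smul_right]
  · intro l _ hl
    rw [inner_smul_right, hν l j hl hj, mul_zero]
  · simp

/-- The heights of the simplex are at least `h / A`. -/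
lemma ShapeRegular.one_le_height (hB : ShapeRegular B A h) {ν : Pt d} {i : Fin (d + 1)}
    (hν1 : ‖ν‖ = 1) (hν : ∀ j j', j ≠ i → j' ≠ i → ⟪ν, B j - B j'⟫ = 0) {j : Fin (d + 1)}
    (hj : j ≠ i) : 1 ≤ A / h * |⟪ν, B j - B i⟫| := by
  -- Moving from a vertex of the face by the unit normal changes the coordinate by `1 / height`.
  have h1 := inner_sub_vertex hν hj (B j + ν)
  rw [add_sub_cancel_left, real_inner_self_eq_norm_sq, hν1, one_pow] at h1
  have h2 := hB.coord_le i (B j + ν) (B j)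
  have h3 : B.coord i (B j) = 0 := by simp [B.coord_apply, hj.symm]
  rw [h3, sub_zero, add_sub_cancel_left, hν1, mul_one] at h2
  have h4 : |⟪ν, B i - B j⟫| = |⟪ν, B j - B i⟫| := by
    rw [← neg_sub (B j) (B i), inner_neg_right, abs_neg]
  calc (1 : ℝ) = |B.coord i (B j + ν) * ⟪ν, B i - B j⟫| := by rw [← h1, abs_one]
    _ = |B.coord i (B j + ν)| * |⟪ν, B j - B i⟫| := by rw [abs_mul, h4]
    _ ≤ _ := mul_le_mul_of_nonneg_right h2 (abs_nonneg _)

lemma ShapeRegular.diam_face_le (hB : ShapeRegular B A h) (e : Fin (n + 1) → Fin (d + 1)) :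
    Metric.diam (convexHull ℝ (Set.range (B ∘ e))) ≤ h := by
  rw [convexHull_diam]
  refine Metric.diam_le_of_forall_dist_le hB.pos.le ?_
  rintro _ ⟨i, rfl⟩ _ ⟨j, rfl⟩
  exact hB.dist_le _ _

lemma ShapeRegular.le_diam_face (hB : ShapeRegular B A h) (hA : 0 < A) (hn : n ≠ 0)
    {e : Fin (n + 1) → Fin (d + 1)} (he : Function.Injective e) :
    h / A ≤ Metric.diam (convexHull ℝ (Set.range (B ∘ e))) := by
  have hne : (0 : Fin (n + 1)) ≠ Fin.last n := by
    simpa [Fin.ext_iff] using hn.symm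
  have h1 := hB.one_le_dist (he.ne hne)
  rw [div_mul_eq_mul_div, one_le_div hB.pos, mul_comm, ← div_le_iff₀ hA] at h1
  rw [convexHull_diam]
  exact h1.trans (Metric.dist_le_diam_of_mem (Set.finite_range _).isBounded ⟨0, rfl⟩
    ⟨Fin.last n, rfl⟩)

end Geometry

/-! ### The Frobenius product and the test tensors -/

section Tensor

open scoped NNReal ENNReal RealInnerProductSpace

variable {d m k : ℕ}

lemma frobProd_self (X : Matrix (Fin d) (Fin d) ℝ) : frobProd X X = ‖X‖ ^ 2 := by
  have h0 : 0 ≤ ∑ i, ∑ j, ‖X i j‖ ^ (2 : ℝ) :=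
    Finset.sum_nonneg fun i _ => Finset.sum_nonneg fun j _ => by positivity
  rw [Matrix.frobenius_norm_def, ← Real.sqrt_eq_rpow, Real.sq_sqrt h0]
  simp [frobProd, sq]

lemma abs_frobProd_le (X Y : Matrix (Fin d) (Fin d) ℝ) : |frobProd X Y| ≤ ‖X‖ * ‖Y‖ := by
  refine abs_le_of_sq_le_sq ?_ (by positivity)
  rw [mul_pow, ← frobProd_self, ← frobProd_self]
  simp only [frobProd, ← Finset.sum_product', ← sq]
  exact Finset.sum_mul_sq_le_sq_mul_sq _ _ _

lemma norm_mulVec_le (X : Matrix (Fin d) (Fin d) ℝ) (u : Pt d) :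
    ‖(WithLp.toLp 2 (X.mulVec u.ofLp) : Pt d)‖ ≤ ‖X‖ * ‖u‖ := by
  have h := Matrix.frobenius_norm_mul X (Matrix.replicateCol Unit u.ofLp)
  rwa [← Matrix.replicateCol_mulVec, Matrix.frobenius_norm_replicateCol,
    Matrix.frobenius_norm_replicateCol] at h

lemma norm_vecMulVec_le (u v : Pt d) : ‖Matrix.vecMulVec u.ofLp v.ofLp‖ ≤ ‖u‖ * ‖v‖ := by
  have h := Matrix.frobenius_norm_mul (Matrix.replicateCol Unit u.ofLp)
    (Matrix.replicateRow Unit v.ofLp)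
  rwa [← Matrix.vecMulVec_eq, Matrix.frobenius_norm_replicateCol,
    Matrix.frobenius_norm_replicateRow] at h

lemma vecMulVec_mulVec_eq (u v w : Pt d) :
    (WithLp.toLp 2 ((Matrix.vecMulVec u.ofLp v.ofLp).mulVec w.ofLp) : Pt d) = ⟪w, v⟫ • u := by
  ext i
  simp only [Matrix.vecMulVec_mulVec, PiLp.smul_apply, smul_eq_mul, PiLp.inner_apply,
    dotProduct]
  simp [mul_comm]

/-- The tensor of degree `k` whose normal component on the face opposite to the vertex `i`, with
normal `ν`, has the Bernstein coefficients `c`, and whose normal components on the other faces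
vanish. In each term one barycentric coordinate is multiplied by the edge from the vertex `i` to the
vertex of that coordinate: that edge is tangential to all faces but two, and on the second one the
coordinate is zero. -/
def testTensor (B : AffineBasis (Fin (m + 2)) ℝ (Pt (m + 1))) (hk : 0 < k) (i : Fin (m + 2))
    (ν : Pt (m + 1)) (c : (Fin k → Fin (m + 1)) → Pt (m + 1)) (x : Pt (m + 1)) :
    Matrix (Fin (m + 1)) (Fin (m + 1)) ℝ :=
  ∑ s, (∏ j, B.coord (i.succAbove (s j)) x) • Matrix.vecMulVec (c s).ofLp
    ((⟪ν, B (i.succAbove (s ⟨0, hk⟩)) - B i⟫)⁻¹ • (B (i.succAbove (s ⟨0, hk⟩)) - B i)).ofLp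

variable {B : AffineBasis (Fin (m + 2)) ℝ (Pt (m + 1))} {A h : ℝ} {i : Fin (m + 2)}
  {ν : Pt (m + 1)} {hk : 0 < k} {c : (Fin k → Fin (m + 1)) → Pt (m + 1)}

lemma testTensor_mem_polyFun : testTensor B hk i ν c ∈ polyFun (m + 1) k _ := by
  have : testTensor B hk i ν c = ∑ s, fun x => (∏ j, B.coord (i.succAbove (s j)) x) •
      Matrix.vecMulVec (c s).ofLp ((⟪ν, B (i.succAbove (s ⟨0, hk⟩)) - B i⟫)⁻¹ •
        (B (i.succAbove (s ⟨0, hk⟩)) - B i)).ofLp := by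
    ext1 x
    simp [testTensor]
  rw [this]
  exact Submodule.sum_mem _ fun s _ => Submodule.subset_span ⟨_, _, rfl⟩

lemma testTensor_mulVec (x ν' : Pt (m + 1)) :
    (WithLp.toLp 2 ((testTensor B hk i ν c x).mulVec ν'.ofLp) : Pt (m + 1)) =
      ∑ s, ((∏ j, B.coord (i.succAbove (s j)) x) *
        ((⟪ν, B (i.succAbove (s ⟨0, hk⟩)) - B i⟫)⁻¹ *
          ⟪ν', B (i.succAbove (s ⟨0, hk⟩)) - B i⟫)) • c s := by
  simp only [testTensor, Matrix.sum_mulVec, Matrix.smul_mulVec, WithLp.toLp_sum, WithLp.toLp_smul,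
    vecMulVec_mulVec_eq, inner_smul_right, smul_smul]

/-- The normal component of the test tensor on its own face is the given polynomial. -/
lemma testTensor_mulVec_self (hB : ShapeRegular B A h) (hν1 : ‖ν‖ = 1)
    (hν : ∀ j j', j ≠ i → j' ≠ i → ⟪ν, B j - B j'⟫ = 0) (y : Pt m) :
    (WithLp.toLp 2 ((testTensor B hk i ν c (simplexMap (B ∘ i.succAbove) y)).mulVec ν.ofLp) :
      Pt (m + 1)) = bern c y := by
  rw [testTensor_mulVec, bern]
  refine Finset.sum_congr rfl fun s _ => ?_
  have hne : ⟪ν, B (i.succAbove (s ⟨0, hk⟩)) - B i⟫ ≠ 0 := fun h0 => by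
    have := hB.one_le_height hν1 hν (Fin.succAbove_ne i (s ⟨0, hk⟩))
    rw [h0, abs_zero, mul_zero] at this
    linarith
  simp only [inv_mul_cancel₀ hne, mul_one,
    coord_simplexMap (Fin.succAbove_right_injective (p := i))]

/-- The normal component of the test tensor on every other face is zero. -/
lemma testTensor_mulVec_of_ne {l : Fin (m + 2)} (hl : l ≠ i) {ν' : Pt (m + 1)}
    (hν' : ∀ j j', j ≠ l → j' ≠ l → ⟪ν', B j - B j'⟫ = 0) (y : Pt m) :
    (WithLp.toLp 2 ((testTensor B hk i ν c (simplexMap (B ∘ l.succAbove) y)).mulVec ν'.ofLp) :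
      Pt (m + 1)) = 0 := by
  rw [testTensor_mulVec]
  refine Finset.sum_eq_zero fun s _ => ?_
  by_cases hs : i.succAbove (s ⟨0, hk⟩) = l
  · rw [Finset.prod_eq_zero (Finset.mem_univ (⟨0, hk⟩ : Fin k)), zero_mul, zero_smul]
    rw [hs]
    exact coord_simplexMap_eq_zero (fun i => Fin.succAbove_ne l i) y
  · rw [hν' _ _ hs hl.symm, mul_zero, mul_zero, zero_smul]

lemma norm_testTensor_le (hB : ShapeRegular B A h) (hν1 : ‖ν‖ = 1)
    (hν : ∀ j j', j ≠ i → j' ≠ i → ⟪ν, B j - B j'⟫ = 0) {x : Pt (m + 1)}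
    (hx : x ∈ convexHull ℝ (Set.range B)) :
    ‖testTensor B hk i ν c x‖ ≤ ((m : ℝ) + 1) ^ k * (A * ‖c‖) := by
  have hh := hB.pos
  have hterm : ∀ s : Fin k → Fin (m + 1), ‖(∏ j, B.coord (i.succAbove (s j)) x) •
      Matrix.vecMulVec (c s).ofLp ((⟪ν, B (i.succAbove (s ⟨0, hk⟩)) - B i⟫)⁻¹ •
        (B (i.succAbove (s ⟨0, hk⟩)) - B i)).ofLp‖ ≤ A * ‖c‖ := fun s => by
    rw [norm_smul]
    have h1 : ‖∏ j, B.coord (i.succAbove (s j)) x‖ ≤ 1 := by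
      rw [Real.norm_eq_abs, abs_of_nonneg (Finset.prod_nonneg fun j _ => (coord_mem_Icc hx _).1)]
      exact Finset.prod_le_one (fun j _ => (coord_mem_Icc hx _).1)
        fun j _ => (coord_mem_Icc hx _).2
    refine (mul_le_of_le_one_left (norm_nonneg _) h1).trans ((norm_vecMulVec_le _ _).trans ?_)
    rw [mul_comm A]
    refine mul_le_mul (norm_le_pi_norm c s) ?_ (norm_nonneg _) (norm_nonneg _)
    have h2 := hB.one_le_height hν1 hν (Fin.succAbove_ne i (s ⟨0, hk⟩))
    set η := ⟪ν, B (i.succAbove (s ⟨0, hk⟩)) - B i⟫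
    have hη : 0 < |η| := abs_pos.2 fun h0 => by
      rw [h0, abs_zero, mul_zero] at h2
      linarith
    rw [norm_smul, norm_inv, Real.norm_eq_abs, inv_mul_le_iff₀ hη, ← dist_eq_norm]
    refine (hB.dist_le _ _).trans ?_
    rw [div_mul_eq_mul_div, one_le_div hh] at h2
    linarith
  refine (norm_sum_le_of_le _ fun s _ => hterm s).trans (le_of_eq ?_)
  simp

end Tensor

/-! ### Norm equivalences on shape-regular simplices -/

section Local

open scoped NNReal ENNReal RealInnerProductSpace

variable {d m n k : ℕ} {E : Type*} [NormedAddCommGroup E] [NormedSpace ℝ E]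

/-- The Bernstein coefficients of a polynomial on a (sub)simplex of a shape-regular simplex can be
chosen so that they are bounded by its `L^q` mean. -/
lemma exists_bern_coeff (n k : ℕ) (E : Type*) [NormedAddCommGroup E] [NormedSpace ℝ E]
    [FiniteDimensional ℝ E] (q : ℝ) (hq : 1 ≤ q) :
    ∃ C : ℝ, 0 < C ∧ ∀ {d : ℕ} {B : AffineBasis (Fin (d + 1)) ℝ (Pt d)} {A h : ℝ},
      0 ≤ A → ShapeRegular B A h → ∀ {e : Fin (n + 1) → Fin (d + 1)}, Function.Injective e →
      ∀ {f : Pt d → E}, f ∈ polyFun d k E → ∃ c : (Fin k → Fin (n + 1)) → E,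
        (∀ x ∈ refSimplex n, f (simplexMap (B ∘ e) x) = bern c x) ∧
        ‖c‖ ^ q ≤ C * ((n * (A / h)) ^ n *
          ∫ x in convexHull ℝ (Set.range (B ∘ e)), ‖f x‖ ^ q ∂μHE[n]) := by
  obtain ⟨g, hg, hgq⟩ := exists_bern_bound n k E
  obtain ⟨C, hC, hCle⟩ := hgq q hq
  refine ⟨C, hC, fun {d B A h} hA hB e he f hf => ?_⟩
  obtain ⟨c, hc⟩ := exists_bern_eq hf (B ∘ e)
  refine ⟨g c, fun x hx => by rw [hg c x hx, hc x], (hCle c).trans ?_⟩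
  refine mul_le_mul_of_nonneg_left ?_ hC.le
  have h1 := setIntegral_refSimplex_le (hB.lipschitzWith e) (hB.antilipschitzWith hA he)
    (g := fun x => ‖f x‖ ^ q)
    ((continuous_of_mem_polyFun hf).norm.rpow_const fun _ => Or.inr (by linarith))
    (fun x => Real.rpow_nonneg (norm_nonneg _) _)
  have := hB.pos
  rw [Real.coe_toNNReal _ (by positivity)] at h1
  simpa only [hc] using h1

/-- Inverse estimate: polynomials are bounded pointwise by their `L^q` means. -/
lemma exists_norm_rpow_le (n k : ℕ) (E : Type*) [NormedAddCommGroup E] [NormedSpace ℝ E]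
    [FiniteDimensional ℝ E] (q : ℝ) (hq : 1 ≤ q) {A : ℝ} (hA : 0 ≤ A) :
    ∃ C : ℝ, 0 < C ∧ ∀ {d : ℕ} {B : AffineBasis (Fin (d + 1)) ℝ (Pt d)} {h : ℝ},
      ShapeRegular B A h → ∀ {e : Fin (n + 1) → Fin (d + 1)}, Function.Injective e →
      ∀ {f : Pt d → E}, f ∈ polyFun d k E → ∀ x ∈ convexHull ℝ (Set.range (B ∘ e)),
        ‖f x‖ ^ q ≤ C * ((h ^ n)⁻¹ *
          ∫ x in convexHull ℝ (Set.range (B ∘ e)), ‖f x‖ ^ q ∂μHE[n]) := by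
  obtain ⟨C, hC, hCle⟩ := exists_bern_coeff n k E q hq
  refine ⟨(((n : ℝ) + 1) ^ k) ^ q * C * ((n * A) ^ n + 1), by positivity,
    fun {d B h} hB e he f hf x hx => ?_⟩
  obtain ⟨c, hc, hcle⟩ := hCle hA hB he hf
  rw [← image_simplexMap] at hx
  obtain ⟨y, hy, rfl⟩ := hx
  rw [hc y hy]
  have hI : 0 ≤ ∫ x in convexHull ℝ (Set.range (B ∘ e)), ‖f x‖ ^ q ∂μHE[n] :=
    integral_nonneg fun x => Real.rpow_nonneg (norm_nonneg _) _
  set I := ∫ x in convexHull ℝ (Set.range (B ∘ e)), ‖f x‖ ^ q ∂μHE[n]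
  have hh := hB.pos
  calc ‖bern c y‖ ^ q ≤ (((n : ℝ) + 1) ^ k * ‖c‖) ^ q :=
        Real.rpow_le_rpow (norm_nonneg _) (norm_bern_le c hy) (by linarith)
    _ = (((n : ℝ) + 1) ^ k) ^ q * ‖c‖ ^ q := Real.mul_rpow (by positivity) (norm_nonneg _)
    _ ≤ (((n : ℝ) + 1) ^ k) ^ q * (C * ((n * (A / h)) ^ n * I)) := by gcongr
    _ = (((n : ℝ) + 1) ^ k) ^ q * C * (n * A) ^ n * ((h ^ n)⁻¹ * I) := by
        rw [← mul_div_assoc, div_pow]; ring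
    _ ≤ _ := by gcongr; linarith

lemma ShapeRegular.norm_setIntegral_le {B : AffineBasis (Fin (d + 1)) ℝ (Pt d)} {A h : ℝ}
    (hB : ShapeRegular B A h) {e : Fin (n + 1) → Fin (d + 1)} {g : Pt d → ℝ} {S : ℝ} (hS : 0 ≤ S)
    (hg : ∀ x ∈ convexHull ℝ (Set.range (B ∘ e)), ‖g x‖ ≤ S) :
    ‖∫ x in convexHull ℝ (Set.range (B ∘ e)), g x ∂μHE[n]‖ ≤
      (n : ℝ) ^ n * volume.real (refSimplex n) * (h ^ n * S) := by
  have h1 := norm_setIntegral_convexHull_le (hB.lipschitzWith e) (g := g) hS fun x hx =>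
    hg _ (image_simplexMap (B ∘ e) ▸ ⟨x, hx, rfl⟩)
  have := hB.pos
  rw [Real.coe_toNNReal _ (by positivity)] at h1
  refine h1.trans_eq ?_
  rw [mul_pow]; ring

lemma ShapeRegular.norm_setIntegral_volume_le {B : AffineBasis (Fin (d + 1)) ℝ (Pt d)} {A h : ℝ}
    (hB : ShapeRegular B A h) {g : Pt d → ℝ} {S : ℝ} (hS : 0 ≤ S)
    (hg : ∀ x ∈ convexHull ℝ (Set.range B), ‖g x‖ ≤ S) :
    ‖∫ x in convexHull ℝ (Set.range B), g x‖ ≤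
      (d : ℝ) ^ d * volume.real (refSimplex d) * (h ^ d * S) := by
  have h1 := hB.norm_setIntegral_le (e := id) hS (g := g) (by simpa using hg)
  simpa only [Function.comp_id, EuclideanSpace.euclideanHausdorffMeasure_eq_volume] using h1

/-! ### The lifting on one element -/

/-- On the simplex with vertices `B`, the tensor `R` is the lifting of the face functions `w i`,
where `i` stands for the face opposite to the vertex `i`, with normal `ν i` and averaging
weight `κ i`. -/
structure IsElementLifting (k : ℕ) (B : AffineBasis (Fin (m + 2)) ℝ (Pt (m + 1)))
    (ν : Fin (m + 2) → Pt (m + 1)) (κ : Fin (m + 2) → ℝ) (w : Fin (m + 2) → Pt (m + 1) → Pt (m + 1))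
    (R : Pt (m + 1) → Matrix (Fin (m + 1)) (Fin (m + 1)) ℝ) : Prop where
  norm_normal : ∀ i, ‖ν i‖ = 1
  orthogonal : ∀ i j j', j ≠ i → j' ≠ i → ⟪ν i, B j - B j'⟫ = 0
  half_le : ∀ i, 1 / 2 ≤ κ i
  le_one : ∀ i, κ i ≤ 1
  w_mem : ∀ i, w i ∈ polyFun (m + 1) k _
  R_mem : R ∈ polyFun (m + 1) k _
  eq : ∀ τ ∈ polyFun (m + 1) k (Matrix (Fin (m + 1)) (Fin (m + 1)) ℝ),
    ∫ x in convexHull ℝ (Set.range B), frobProd (R x) (τ x) =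
      ∑ i, κ i * ∫ x in convexHull ℝ (Set.range (B ∘ i.succAbove)),
        ⟪w i x, WithLp.toLp 2 ((τ x).mulVec (ν i).ofLp)⟫ ∂μHE[m]

/-- The face functions are controlled by their lifting: test with the tensor whose normal component
is `w i` on the face `i` and zero on the other faces. -/
lemma exists_norm_face_le (m : ℕ) (hk : 0 < k) {A : ℝ} (hA : 0 < A) :
    ∃ C : ℝ, 0 < C ∧ ∀ {B : AffineBasis (Fin (m + 2)) ℝ (Pt (m + 1))} {h : ℝ},
      ShapeRegular B A h → ∀ {ν κ w R}, IsElementLifting k B ν κ w R → ∀ {S : ℝ}, 0 ≤ S →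
      (∀ x ∈ convexHull ℝ (Set.range B), ‖R x‖ ≤ S) →
      ∀ i, ∀ x ∈ convexHull ℝ (Set.range (B ∘ i.succAbove)), ‖w i x‖ ≤ C * (h * S) := by
  obtain ⟨C₂, hC₂, hcoeff⟩ := exists_bern_coeff m k (Pt (m + 1)) 2 one_le_two
  set N : ℝ := ((m : ℝ) + 1) ^ k with hN
  have hN0 : 0 < N := by positivity
  set V : ℝ := ((m + 1 : ℕ) : ℝ) ^ (m + 1) * volume.real (refSimplex (m + 1)) with hV
  have hV0 : 0 ≤ V := by positivity
  refine ⟨N * (C₂ * (m * A) ^ m * 2 * V * N * A + 1), by positivity,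
    fun {B h} hB ν κ w R hR S hS hRS i x hx => ?_⟩
  have hh := hB.pos
  obtain ⟨c, hc, hcle⟩ := hcoeff hA.le hB (Fin.succAbove_right_injective (p := i)) (hR.w_mem i)
  have hface : ∀ l, ∀ z ∈ convexHull ℝ (Set.range (B ∘ Fin.succAbove l)),
      ∃ y ∈ refSimplex m, simplexMap (B ∘ Fin.succAbove l) y = z := fun l z hz => by
    rwa [← image_simplexMap] at hz
  have hmeas : ∀ l : Fin (m + 2), MeasurableSet (convexHull ℝ (Set.range (B ∘ l.succAbove))) :=
    fun l => (isCompact_convexHull_range _).measurableSet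
  let τ := testTensor B hk i (ν i) c
  have heq := hR.eq τ testTensor_mem_polyFun
  -- Only the face opposite to the vertex `i` contributes, where the normal component is `w i`.
  have hsum : (∑ l, κ l * ∫ z in convexHull ℝ (Set.range (B ∘ l.succAbove)),
      ⟪w l z, WithLp.toLp 2 ((τ z).mulVec (ν l).ofLp)⟫ ∂μHE[m]) =
      κ i * ∫ z in convexHull ℝ (Set.range (B ∘ i.succAbove)), ‖w i z‖ ^ (2 : ℝ) ∂μHE[m] := by
    rw [Finset.sum_eq_single i]
    · congr 1
      refine setIntegral_congr_fun (hmeas i) fun z hz => ?_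
      obtain ⟨y, hy, rfl⟩ := hface i z hz
      simp only [τ, testTensor_mulVec_self hB (hR.norm_normal i) (hR.orthogonal i)]
      rw [hc y hy, real_inner_self_eq_norm_sq, Real.rpow_two]
    · intro l _ hl
      rw [setIntegral_eq_zero_of_forall_eq_zero, mul_zero]
      intro z hz
      obtain ⟨y, hy, rfl⟩ := hface l z hz
      rw [testTensor_mulVec_of_ne hl (hR.orthogonal l), inner_zero_right]
    · simp
  rw [hsum] at heq
  have hI0 : 0 ≤ ∫ z in convexHull ℝ (Set.range (B ∘ i.succAbove)), ‖w i z‖ ^ (2 : ℝ) ∂μHE[m] :=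
    integral_nonneg fun x => Real.rpow_nonneg (norm_nonneg _) _
  set I := ∫ z in convexHull ℝ (Set.range (B ∘ i.succAbove)), ‖w i z‖ ^ (2 : ℝ) ∂μHE[m]
  have hT := hB.norm_setIntegral_volume_le (g := fun x => frobProd (R x) (τ x))
    (S := S * (N * (A * ‖c‖))) (by positivity) fun z hz => by
      rw [Real.norm_eq_abs]
      exact (abs_frobProd_le _ _).trans (mul_le_mul (hRS z hz)
        (norm_testTensor_le hB (hR.norm_normal i) (hR.orthogonal i) hz) (norm_nonneg _) hS)
  rw [heq] at hT
  have hI : I ≤ 2 * (V * (h ^ (m + 1) * (S * (N * (A * ‖c‖))))) := by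
    have h1 : 1 / 2 * I ≤ κ i * I := mul_le_mul_of_nonneg_right (hR.half_le i) hI0
    have h2 := (Real.le_norm_self _).trans hT
    linarith
  have hcS : ‖c‖ ≤ C₂ * (m * A) ^ m * 2 * V * N * A * (h * S) := by
    rcases (norm_nonneg c).eq_or_lt with h0 | h0
    · rw [← h0]; positivity
    refine le_of_mul_le_mul_right ?_ h0
    calc ‖c‖ * ‖c‖ = ‖c‖ ^ (2 : ℝ) := by rw [Real.rpow_two, sq]
      _ ≤ C₂ * ((m * (A / h)) ^ m * I) := hcle
      _ ≤ C₂ * ((m * (A / h)) ^ m * (2 * (V * (h ^ (m + 1) * (S * (N * (A * ‖c‖))))))) := by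
        gcongr
      _ = _ := by
        rw [← mul_div_assoc, div_pow, pow_succ]; field_simp
  obtain ⟨y, hy, rfl⟩ := hface i x hx
  rw [hc y hy]
  calc ‖bern c y‖ ≤ N * ‖c‖ := norm_bern_le c hy
    _ ≤ N * (C₂ * (m * A) ^ m * 2 * V * N * A * (h * S)) := by gcongr
    _ ≤ N * ((C₂ * (m * A) ^ m * 2 * V * N * A + 1) * (h * S)) := by gcongr; linarith
    _ = _ := by ring

/-- The lifting is controlled by the face functions: test with the lifting itself. -/
lemma exists_norm_lifting_le (m k : ℕ) {A : ℝ} (hA : 0 < A) :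
    ∃ C : ℝ, 0 < C ∧ ∀ {B : AffineBasis (Fin (m + 2)) ℝ (Pt (m + 1))} {h : ℝ},
      ShapeRegular B A h → ∀ {ν κ w R}, IsElementLifting k B ν κ w R →
      ∀ {s : Fin (m + 2) → ℝ}, (∀ i, 0 ≤ s i) →
      (∀ i, ∀ x ∈ convexHull ℝ (Set.range (B ∘ i.succAbove)), ‖w i x‖ ≤ s i) →
      ∀ x ∈ convexHull ℝ (Set.range B), ‖R x‖ ≤ C * (h⁻¹ * ∑ i, s i) := by
  obtain ⟨C₂, hC₂, hcoeff⟩ := exists_bern_coeff (m + 1) k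
    (Matrix (Fin (m + 1)) (Fin (m + 1)) ℝ) 2 one_le_two
  set N : ℝ := (((m + 1 : ℕ) : ℝ) + 1) ^ k with hN
  have hN0 : 0 < N := by positivity
  set V : ℝ := (m : ℝ) ^ m * volume.real (refSimplex m) with hV
  have hV0 : 0 ≤ V := by positivity
  refine ⟨N * (C₂ * ((m + 1 : ℕ) * A) ^ (m + 1) * V * N + 1), by positivity,
    fun {B h} hB ν κ w R hR s hs hws x hx => ?_⟩
  have hh := hB.pos
  obtain ⟨c, hc, hcle⟩ := hcoeff hA.le hB Function.injective_id hR.R_mem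
  rw [Function.comp_id] at hc hcle
  rw [EuclideanSpace.euclideanHausdorffMeasure_eq_volume] at hcle
  have hcell : ∀ z ∈ convexHull ℝ (Set.range B), ‖R z‖ ≤ N * ‖c‖ := fun z hz => by
    rw [← image_simplexMap] at hz
    obtain ⟨y, hy, rfl⟩ := hz
    rw [hc y hy]
    exact norm_bern_le c hy
  have hI : ∫ z in convexHull ℝ (Set.range B), ‖R z‖ ^ (2 : ℝ) ≤
      ∑ i, V * (h ^ m * (s i * (N * ‖c‖))) := by
    have h1 : ∫ z in convexHull ℝ (Set.range B), ‖R z‖ ^ (2 : ℝ) =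
        ∫ z in convexHull ℝ (Set.range B), frobProd (R z) (R z) := by
      simp only [frobProd_self, Real.rpow_two]
    rw [h1, hR.eq R hR.R_mem]
    refine Finset.sum_le_sum fun i _ => ?_
    have hsub : convexHull ℝ (Set.range (B ∘ i.succAbove)) ⊆ convexHull ℝ (Set.range B) :=
      convexHull_mono (Set.range_comp_subset_range _ _)
    have h2 := hB.norm_setIntegral_le (e := i.succAbove)
      (g := fun z => ⟪w i z, WithLp.toLp 2 ((R z).mulVec (ν i).ofLp)⟫)
      (S := s i * (N * ‖c‖)) (mul_nonneg (hs i) (by positivity)) fun z hz => by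
        refine (norm_inner_le_norm _ _).trans (mul_le_mul (hws i z hz) ?_ (norm_nonneg _) (hs i))
        refine (norm_mulVec_le _ _).trans ?_
        rw [hR.norm_normal, mul_one]
        exact hcell z (hsub hz)
    have h3 := hR.half_le i
    calc _ ≤ |κ i * _| := le_abs_self _
      _ = κ i * ‖_‖ := by rw [abs_mul, abs_of_nonneg (by linarith), Real.norm_eq_abs]
      _ ≤ 1 * ‖_‖ := mul_le_mul_of_nonneg_right (hR.le_one i) (norm_nonneg _)
      _ ≤ _ := by rw [one_mul]; exact h2
  rw [← Finset.mul_sum, ← Finset.mul_sum, ← Finset.sum_mul] at hI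
  have hs0 : 0 ≤ ∑ i, s i := Finset.sum_nonneg fun i _ => hs i
  set σ := ∑ i, s i
  have hcS : ‖c‖ ≤ C₂ * ((m + 1 : ℕ) * A) ^ (m + 1) * V * N * (h⁻¹ * σ) := by
    rcases (norm_nonneg c).eq_or_lt with h0 | h0
    · rw [← h0]; positivity
    refine le_of_mul_le_mul_right ?_ h0
    calc ‖c‖ * ‖c‖ = ‖c‖ ^ (2 : ℝ) := by rw [Real.rpow_two, sq]
      _ ≤ _ := hcle
      _ ≤ C₂ * (((m + 1 : ℕ) * (A / h)) ^ (m + 1) * (V * (h ^ m * (σ * (N * ‖c‖))))) := by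
        gcongr
      _ = _ := by
        rw [← mul_div_assoc, div_pow, pow_succ h]; field_simp
  calc ‖R x‖ ≤ N * ‖c‖ := hcell x hx
    _ ≤ N * (C₂ * ((m + 1 : ℕ) * A) ^ (m + 1) * V * N * (h⁻¹ * σ)) := by gcongr
    _ ≤ N * ((C₂ * ((m + 1 : ℕ) * A) ^ (m + 1) * V * N + 1) * (h⁻¹ * σ)) := by gcongr; linarith
    _ = _ := by ring

end Local

section LocalRpow

variable {m k : ℕ} {A q : ℝ}

lemma le_rpow_inv_of_rpow_le {x y : ℝ} (hx : 0 ≤ x) (hq : 0 < q) (h : x ^ q ≤ y) :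
    x ≤ y ^ q⁻¹ := by
  rw [← Real.rpow_rpow_inv hx hq.ne']
  exact Real.rpow_le_rpow (Real.rpow_nonneg hx _) h (inv_nonneg.2 hq.le)

/-- Lower `L^q` bound for the lifting on one element. -/
lemma exists_sum_face_le (hm : m ≠ 0) (hk : 0 < k) (hq : 1 ≤ q) (hA : 0 < A) :
    ∃ C : ℝ, 0 < C ∧ ∀ {B : AffineBasis (Fin (m + 2)) ℝ (Pt (m + 1))} {h : ℝ},
      ShapeRegular B A h → ∀ {ν κ w R}, IsElementLifting k B ν κ w R →
      ∑ i, Metric.diam (convexHull ℝ (Set.range (B ∘ Fin.succAbove i))) ^ (1 - q) *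
        ∫ x in convexHull ℝ (Set.range (B ∘ i.succAbove)), ‖w i x‖ ^ q ∂μHE[m] ≤
      C * ∫ x in convexHull ℝ (Set.range B), ‖R x‖ ^ q := by
  obtain ⟨C₁, hC₁, hinv⟩ := exists_norm_rpow_le (m + 1) k
    (Matrix (Fin (m + 1)) (Fin (m + 1)) ℝ) q hq hA.le
  obtain ⟨C₂, hC₂, hface⟩ := exists_norm_face_le m hk hA
  have hq0 : 0 < q := by linarith
  set V : ℝ := (m : ℝ) ^ m * volume.real (refSimplex m) with hV
  have hV0 : 0 ≤ V := by positivity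
  refine ⟨(m + 2 : ℕ) * ((A ^ (1 - q))⁻¹ * V * C₂ ^ q * C₁ + 1), by positivity,
    fun {B h} hB ν κ w R hR => ?_⟩
  have hh := hB.pos
  have hJ0 : 0 ≤ ∫ x in convexHull ℝ (Set.range B), ‖R x‖ ^ q :=
    integral_nonneg fun x => Real.rpow_nonneg (norm_nonneg _) _
  have hinv' := hinv hB Function.injective_id hR.R_mem
  rw [Function.comp_id, EuclideanSpace.euclideanHausdorffMeasure_eq_volume] at hinv'
  set J := ∫ x in convexHull ℝ (Set.range B), ‖R x‖ ^ q
  set P := C₁ * ((h ^ (m + 1))⁻¹ * J) with hP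
  have hP0 : 0 ≤ P := by positivity
  have hw := hface hB hR (Real.rpow_nonneg hP0 q⁻¹) fun x hx =>
    le_rpow_inv_of_rpow_le (norm_nonneg _) hq0 (hinv' x hx)
  have hterm : ∀ i : Fin (m + 2),
      Metric.diam (convexHull ℝ (Set.range (B ∘ Fin.succAbove i))) ^ (1 - q) *
        ∫ x in convexHull ℝ (Set.range (B ∘ i.succAbove)), ‖w i x‖ ^ q ∂μHE[m] ≤
      ((A ^ (1 - q))⁻¹ * V * C₂ ^ q * C₁ + 1) * J := fun i => by
    have hdiam : Metric.diam (convexHull ℝ (Set.range (B ∘ Fin.succAbove i))) ^ (1 - q) ≤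
        (h / A) ^ (1 - q) :=
      Real.rpow_le_rpow_of_nonpos (by positivity)
        (hB.le_diam_face hA hm Fin.succAbove_right_injective) (by linarith)
    have hint := (Real.le_norm_self _).trans (hB.norm_setIntegral_le (e := i.succAbove)
      (g := fun x => ‖w i x‖ ^ q) (S := C₂ ^ q * h ^ q * P) (by positivity) fun x hx => by
        rw [Real.norm_of_nonneg (Real.rpow_nonneg (norm_nonneg _) _)]
        refine (Real.rpow_le_rpow (norm_nonneg _) (hw i x hx) hq0.le).trans_eq ?_
        rw [Real.mul_rpow hC₂.le (by positivity), Real.mul_rpow hh.le (by positivity),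
          Real.rpow_inv_rpow hP0 hq0.ne', mul_assoc])
    -- The powers of `h` from the face weight, `‖w i‖ ^ q`, the face and the element cancel.
    have hpow : h ^ (1 - q) * h ^ q = h := by
      rw [← Real.rpow_add hh]; simp
    calc _ ≤ (h / A) ^ (1 - q) * (V * (h ^ m * (C₂ ^ q * h ^ q * P))) :=
          mul_le_mul hdiam hint (integral_nonneg fun x => Real.rpow_nonneg (norm_nonneg _) _)
            (by positivity)
      _ = (A ^ (1 - q))⁻¹ * V * C₂ ^ q * C₁ *
          ((h ^ (1 - q) * h ^ q) * h ^ m * (h ^ (m + 1))⁻¹ * J) := by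
          rw [Real.div_rpow hh.le hA.le, hP]; ring
      _ = (A ^ (1 - q))⁻¹ * V * C₂ ^ q * C₁ * J := by
          rw [hpow, ← pow_succ', mul_inv_cancel₀ (by positivity), one_mul]
      _ ≤ _ := by gcongr; linarith
  refine (Finset.sum_le_sum fun i _ => hterm i).trans_eq ?_
  simp; ring

/-- Upper `L^q` bound for the lifting on one element. -/
lemma exists_integral_lifting_le (hm : m ≠ 0) (hq : 1 ≤ q) (hA : 0 < A) :
    ∃ C : ℝ, 0 < C ∧ ∀ {B : AffineBasis (Fin (m + 2)) ℝ (Pt (m + 1))} {h : ℝ},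
      ShapeRegular B A h → ∀ {ν κ w R}, IsElementLifting k B ν κ w R →
      ∫ x in convexHull ℝ (Set.range B), ‖R x‖ ^ q ≤
      C * ∑ i, Metric.diam (convexHull ℝ (Set.range (B ∘ Fin.succAbove i))) ^ (1 - q) *
        ∫ x in convexHull ℝ (Set.range (B ∘ i.succAbove)), ‖w i x‖ ^ q ∂μHE[m] := by
  obtain ⟨C₁, hC₁, hinv⟩ := exists_norm_rpow_le m k (Pt (m + 1)) q hq hA.le
  obtain ⟨C₂, hC₂, hlift⟩ := exists_norm_lifting_le m k hA
  have hq0 : 0 < q := by linarith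
  set V : ℝ := ((m + 1 : ℕ) : ℝ) ^ (m + 1) * volume.real (refSimplex (m + 1)) with hV
  have hV0 : 0 ≤ V := by positivity
  set N : ℝ := ((m + 2 : ℕ) : ℝ) ^ (q - 1) with hN
  have hN0 : 0 ≤ N := by positivity
  refine ⟨V * C₂ ^ q * N * C₁ + 1, by positivity, fun {B h} hB ν κ w R hR => ?_⟩
  have hh := hB.pos
  let J : Fin (m + 2) → ℝ := fun i =>
    ∫ x in convexHull ℝ (Set.range (B ∘ i.succAbove)), ‖w i x‖ ^ q ∂μHE[m]
  have hJ0 : ∀ i, 0 ≤ J i := fun i => integral_nonneg fun x => Real.rpow_nonneg (norm_nonneg _) _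
  let P : Fin (m + 2) → ℝ := fun i => C₁ * ((h ^ m)⁻¹ * J i)
  have hP0 : ∀ i, 0 ≤ P i := fun i => mul_nonneg hC₁.le (mul_nonneg (by positivity) (hJ0 i))
  have hs0 : ∀ i, 0 ≤ P i ^ q⁻¹ := fun i => Real.rpow_nonneg (hP0 i) _
  have hR' := hlift hB hR hs0 fun i x hx => le_rpow_inv_of_rpow_le (norm_nonneg _) hq0
    (hinv hB Fin.succAbove_right_injective (hR.w_mem i) x hx)
  have hsum0 : 0 ≤ ∑ i, P i ^ q⁻¹ := Finset.sum_nonneg fun i _ => hs0 i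
  have hsum : (∑ i, P i ^ q⁻¹) ^ q ≤ N * ∑ i, P i := by
    have h1 := Real.rpow_sum_le_const_mul_sum_rpow_of_nonneg (s := Finset.univ) hq
      (fun i _ => hs0 i)
    simpa only [Finset.card_univ, Fintype.card_fin, Real.rpow_inv_rpow (hP0 _) hq0.ne'] using h1
  have hint := (Real.le_norm_self _).trans (hB.norm_setIntegral_volume_le
    (g := fun x => ‖R x‖ ^ q) (S := C₂ ^ q * (h ^ q)⁻¹ * (N * ∑ i, P i))
    (mul_nonneg (by positivity) (mul_nonneg hN0 (Finset.sum_nonneg fun i _ => hP0 i)))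
    fun x hx => by
      rw [Real.norm_of_nonneg (Real.rpow_nonneg (norm_nonneg _) _)]
      refine (Real.rpow_le_rpow (norm_nonneg _) (hR' x hx) hq0.le).trans ?_
      rw [Real.mul_rpow hC₂.le (by positivity), Real.mul_rpow (by positivity) hsum0,
        Real.inv_rpow hh.le, ← mul_assoc]
      gcongr)
  have hpow : h ^ (1 - q) = h * (h ^ q)⁻¹ := by
    rw [Real.rpow_sub hh, Real.rpow_one, div_eq_mul_inv]
  have hdiam : ∀ i : Fin (m + 2), h ^ (1 - q) ≤
      Metric.diam (convexHull ℝ (Set.range (B ∘ Fin.succAbove i))) ^ (1 - q) := fun i =>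
    Real.rpow_le_rpow_of_nonpos ((by positivity : 0 < h / A).trans_le
      (hB.le_diam_face hA hm Fin.succAbove_right_injective)) (hB.diam_face_le _) (by linarith)
  have hle : h ^ (1 - q) * ∑ i, J i ≤
      ∑ i, Metric.diam (convexHull ℝ (Set.range (B ∘ Fin.succAbove i))) ^ (1 - q) * J i := by
    rw [Finset.mul_sum]
    exact Finset.sum_le_sum fun i _ => mul_le_mul_of_nonneg_right (hdiam i) (hJ0 i)
  have hJs : 0 ≤ ∑ i, J i := Finset.sum_nonneg fun i _ => hJ0 i
  have hsumP : ∑ i, P i = C₁ * ((h ^ m)⁻¹ * ∑ i, J i) := by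
    simp only [P, Finset.mul_sum]
  calc _ ≤ V * (h ^ (m + 1) * (C₂ ^ q * (h ^ q)⁻¹ * (N * ∑ i, P i))) := hint
    _ = V * C₂ ^ q * N * C₁ * (h ^ (1 - q) * ∑ i, J i) := by
        rw [hsumP, hpow, pow_succ]; field_simp
    _ ≤ (V * C₂ ^ q * N * C₁ + 1) * (h ^ (1 - q) * ∑ i, J i) := by gcongr; linarith
    _ ≤ _ := by gcongr

end LocalRpow

/-! ### Polynomial functions as evaluations of polynomials -/

section Polynomial

variable {d k : ℕ} {E : Type*} [NormedAddCommGroup E] [NormedSpace ℝ E]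

/-- A monomial of degree at most `k` is a product of `k` affine functions: coordinates, padded with
the constant `1`. -/
lemma exists_prod_affine_eq (k : ℕ) (s : Fin d →₀ ℕ) (hs : (s.sum fun _ e => e) ≤ k) :
    ∃ l : Fin k → Pt d →ᵃ[ℝ] ℝ, ∀ x, (s.prod fun i e => x i ^ e) = ∏ j, l j x := by
  induction k generalizing s with
  | zero =>
    have h0 : s = 0 := by
      ext i
      by_contra hi
      have := Finset.single_le_sum (f := fun i => s i) (fun _ _ => Nat.zero_le _)
        (Finsupp.mem_support_iff.2 hi)
      simp only [Finsupp.sum] at hs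
      simp only [Finsupp.coe_zero, Pi.zero_apply] at hi
      omega
    exact ⟨fun _ => AffineMap.const ℝ _ 0, fun x => by simp [h0]⟩
  | succ k ih =>
    rcases eq_or_ne s 0 with rfl | h0
    · exact ⟨fun _ => AffineMap.const ℝ _ 1, fun x => by simp⟩
    · obtain ⟨i, hi⟩ := Finsupp.ne_iff.1 h0
      have hle : Finsupp.single i 1 ≤ s := by
        rw [Finsupp.single_le_iff]
        exact Nat.one_le_iff_ne_zero.2 hi
      obtain ⟨t, rfl⟩ := exists_add_of_le hle
      rw [Finsupp.sum_add_index' (fun _ => rfl) (fun _ _ _ => rfl),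
        Finsupp.sum_single_index rfl] at hs
      obtain ⟨l, hl⟩ := ih t (by omega)
      refine ⟨Fin.cons (EuclideanSpace.proj i : Pt d →L[ℝ] ℝ).toLinearMap.toAffineMap l,
        fun x => ?_⟩
      refine (Finsupp.prod_add_index' (h := fun i e => x i ^ e) (fun _ => pow_zero _)
        (fun _ _ _ => pow_add _ _ _)).trans ?_
      rw [hl, Fin.prod_univ_succ, Finsupp.prod_single_index (h := fun i e => x i ^ e) (pow_zero _)]
      simp

lemma eval_smul_mem_polyFun {p : MvPolynomial (Fin d) ℝ} (hp : p.totalDegree ≤ k) (e : E) :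
    (fun x : Pt d => MvPolynomial.eval x.ofLp p • e) ∈ polyFun d k E := by
  have h : (fun x : Pt d => MvPolynomial.eval x.ofLp p • e) = ∑ s ∈ p.support,
      MvPolynomial.coeff s p • fun x : Pt d => (s.prod fun i n => x i ^ n) • e := by
    ext1 x
    rw [MvPolynomial.eval_eq, Finset.sum_smul, Finset.sum_apply]
    simp only [Pi.smul_apply, smul_smul]
    refine Finset.sum_congr rfl fun s _ => ?_
    rw [Finsupp.prod]
  rw [h]
  refine Submodule.sum_mem _ fun s hs => Submodule.smul_mem _ _ (Submodule.subset_span ?_)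
  obtain ⟨l, hl⟩ := exists_prod_affine_eq k s ((MvPolynomial.le_totalDegree hs).trans hp)
  exact ⟨l, e, funext fun x => by rw [hl]⟩

lemma exists_totalDegree_le_one (l : Pt d →ᵃ[ℝ] ℝ) :
    ∃ p : MvPolynomial (Fin d) ℝ, p.totalDegree ≤ 1 ∧ ∀ x : Pt d,
      MvPolynomial.eval x.ofLp p = l x := by
  refine ⟨MvPolynomial.C (l 0) + ∑ i, MvPolynomial.C (l.linear (EuclideanSpace.single i 1)) *
    MvPolynomial.X i, ?_, fun x => ?_⟩
  · refine (MvPolynomial.totalDegree_add _ _).trans (max_le (by simp) ?_)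
    refine MvPolynomial.totalDegree_finsetSum_le fun i _ => ?_
    refine (MvPolynomial.totalDegree_mul _ _).trans ?_
    simp
  · have h1 : l x = l.linear x + l 0 := by simpa using l.map_vadd 0 x
    have h2 : x = ∑ i, x i • EuclideanSpace.single i (1 : ℝ) := by
      ext j
      simp [Finset.sum_apply, Pi.single_apply]
    rw [h1]
    conv_rhs => rw [h2]
    simp [mul_comm, add_comm]

lemma exists_eval_eq_of_mem_polyFun {f : Pt d → Matrix (Fin d) (Fin d) ℝ}
    (hf : f ∈ polyFun d k (Matrix (Fin d) (Fin d) ℝ)) :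
    ∃ p : Fin d × Fin d → MvPolynomial.restrictTotalDegree (Fin d) ℝ k, ∀ x i j,
      f x i j = MvPolynomial.eval x.ofLp (p (i, j) : MvPolynomial (Fin d) ℝ) := by
  induction hf using Submodule.span_induction with
  | mem f hf =>
    obtain ⟨l, e, rfl⟩ := hf
    choose p hp hpl using fun j => exists_totalDegree_le_one (l j)
    refine ⟨fun ij => ⟨MvPolynomial.C (e ij.1 ij.2) * ∏ j, p j, ?_⟩, fun x i j => ?_⟩
    · rw [MvPolynomial.mem_restrictTotalDegree]
      refine (MvPolynomial.totalDegree_mul _ _).trans ?_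
      rw [MvPolynomial.totalDegree_C, zero_add]
      refine (MvPolynomial.totalDegree_finsetProd _ _).trans ?_
      exact (Finset.sum_le_sum fun j _ => hp j).trans (by simp)
    · simp [hpl, mul_comm, map_prod]
  | zero => exact ⟨0, fun x i j => by simp⟩
  | add f g _ _ hf hg =>
    obtain ⟨p, hp⟩ := hf
    obtain ⟨p', hp'⟩ := hg
    exact ⟨p + p', fun x i j => by simp [hp, hp']⟩
  | smul t f _ hf =>
    obtain ⟨p, hp⟩ := hf
    exact ⟨t • p, fun x i j => by simp [hp]⟩

end Polynomial

namespace SimplicialMesh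

/-! ### Elements and faces of the mesh -/

section Mesh

open scoped RealInnerProductSpace

variable {m k : ℕ} {Ω : Set (Pt (m + 1))} {M : SimplicialMesh Ω}

lemma exists_eltBasis (T : M.Elt) :
    ∃ B : AffineBasis (Fin (m + 2)) ℝ (Pt (m + 1)), Set.range B = (T.1 : Set (Pt (m + 1))) := by
  let e : Fin (m + 2) ≃ T.1 := (Finset.equivFinOfCardEq (elt_card T)).symm
  have hr : Set.range (fun i => (e i : Pt (m + 1))) = (T.1 : Set (Pt (m + 1))) := by
    ext x
    constructor
    · rintro ⟨i, rfl⟩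
      exact (e i).2
    · intro hx
      exact ⟨e.symm ⟨x, hx⟩, by simp⟩
  have hind : AffineIndependent ℝ (fun i => (e i : Pt (m + 1))) :=
    (M.indep (elt_mem_faces T)).comp_embedding e.toEmbedding
  refine ⟨⟨fun i => e i, hind, ?_⟩, hr⟩
  rw [hr]
  exact interior_convexHull_nonempty_iff_affineSpan_eq_top.1 (interior_cell_nonempty T)

/-- An enumeration of the vertices of the element `T`. -/
def eltBasis (T : M.Elt) : AffineBasis (Fin (m + 2)) ℝ (Pt (m + 1)) := (exists_eltBasis T).choose

lemma range_eltBasis (T : M.Elt) : Set.range (eltBasis T) = (T.1 : Set (Pt (m + 1))) :=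
  (exists_eltBasis T).choose_spec

lemma cell_eq (T : M.Elt) : cell T.1 = convexHull ℝ (Set.range (eltBasis T)) := by
  rw [range_eltBasis]

open Classical in
/-- The face of the element `T` opposite to the vertex `i`. -/
def eltFace (T : M.Elt) (i : Fin (m + 2)) : Finset (Pt (m + 1)) :=
  Finset.univ.image (eltBasis T ∘ i.succAbove)

lemma coe_eltFace (T : M.Elt) (i : Fin (m + 2)) :
    (eltFace T i : Set (Pt (m + 1))) = Set.range (eltBasis T ∘ i.succAbove) := by
  rw [eltFace, Finset.coe_image, Finset.coe_univ, Set.image_univ]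

lemma cell_eltFace (T : M.Elt) (i : Fin (m + 2)) :
    cell (eltFace T i) = convexHull ℝ (Set.range (eltBasis T ∘ i.succAbove)) := by
  rw [cell, coe_eltFace]

lemma mem_eltFace_iff {T : M.Elt} {i j : Fin (m + 2)} : eltBasis T j ∈ eltFace T i ↔ j ≠ i := by
  rw [← Finset.mem_coe, coe_eltFace]
  constructor
  · rintro ⟨l, hl⟩ rfl
    exact Fin.succAbove_ne _ _ ((eltBasis T).ind.injective hl)
  · intro hj
    obtain ⟨l, rfl⟩ := Fin.exists_succAbove_eq hj
    exact ⟨l, rfl⟩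

lemma eltFace_injective (T : M.Elt) : Function.Injective (eltFace T) := fun i j hij => by
  by_contra hne
  exact mem_eltFace_iff.1 (hij ▸ mem_eltFace_iff.2 hne) rfl

lemma eltFace_subset (T : M.Elt) (i : Fin (m + 2)) : eltFace T i ⊆ T.1 := by
  rw [← Finset.coe_subset, coe_eltFace, ← range_eltBasis]
  exact Set.range_comp_subset_range _ _

lemma card_eltFace (T : M.Elt) (i : Fin (m + 2)) : (eltFace T i).card = m + 1 := by
  rw [eltFace, Finset.card_image_of_injective _
    ((eltBasis T).ind.injective.comp Fin.succAbove_right_injective)]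
  simp

lemma eltFace_mem_meshFaces (T : M.Elt) (i : Fin (m + 2)) : eltFace T i ∈ M.meshFaces := by
  simp only [meshFaces, Finset.mem_filter, Set.Finite.mem_toFinset]
  refine ⟨M.down_closed (elt_mem_faces T) (eltFace_subset T i) ?_, card_eltFace T i⟩
  rw [← Finset.card_pos, card_eltFace]
  omega

lemma mem_elementsOf {F : Finset (Pt (m + 1))} {T : M.Elt} : T ∈ M.elementsOf F ↔ F ⊆ T.1 := by
  simp [elementsOf]

lemma exists_eltFace_eq {F : Finset (Pt (m + 1))} (hF : F ∈ M.meshFaces) {T : M.Elt}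
    (hT : F ⊆ T.1) : ∃ i, eltFace T i = F := by
  classical
  have hc : F.card = m + 1 := (Finset.mem_filter.1 hF).2
  have hlt : F.card < T.1.card := by rw [hc, elt_card]; omega
  obtain ⟨x, hxT, hxF⟩ := Finset.exists_mem_notMem_of_card_lt_card hlt
  have hx : x ∈ Set.range (eltBasis T) := by rw [range_eltBasis]; exact hxT
  obtain ⟨i, rfl⟩ := hx
  refine ⟨i, (Finset.eq_of_subset_of_card_le (fun y hy => ?_) (by rw [hc, card_eltFace])).symm⟩
  have hy' : y ∈ Set.range (eltBasis T) := by rw [range_eltBasis]; exact hT hy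
  obtain ⟨j, rfl⟩ := hy'
  exact mem_eltFace_iff.2 fun h => hxF (h ▸ hy)

open Classical in
lemma sum_eltFace (T : M.Elt) (g : Finset (Pt (m + 1)) → ℝ) :
    ∑ F ∈ M.meshFaces, (if T ∈ M.elementsOf F then g F else 0) = ∑ i, g (eltFace T i) := by
  rw [← Finset.sum_filter]
  have h : M.meshFaces.filter (fun F => T ∈ M.elementsOf F) = Finset.univ.image (eltFace T) := by
    ext F
    simp only [Finset.mem_filter, Finset.mem_image, Finset.mem_univ, true_and, mem_elementsOf]
    constructor
    · rintro ⟨hF, hT⟩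
      exact exists_eltFace_eq hF hT
    · rintro ⟨i, rfl⟩
      exact ⟨eltFace_mem_meshFaces T i, eltFace_subset T i⟩
  rw [h, Finset.sum_image fun i _ j _ hij => eltFace_injective T hij]

lemma normal_orthogonal (n : M.FaceNormals) (T : M.Elt) (i j j' : Fin (m + 2)) (hj : j ≠ i)
    (hj' : j' ≠ i) : ⟪n.normal (eltFace T i), eltBasis T j - eltBasis T j'⟫ = 0 :=
  n.orthogonal _ (eltFace_mem_meshFaces T i) _ (mem_eltFace_iff.2 hj') _ (mem_eltFace_iff.2 hj)

lemma elementsOf_nonempty {F : Finset (Pt (m + 1))} (hF : F ∈ M.meshFaces) :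
    (M.elementsOf F).Nonempty := by
  simp only [meshFaces, Finset.mem_filter, Set.Finite.mem_toFinset] at hF
  obtain ⟨t, ht, hFt, hc⟩ := M.pure F hF.1
  refine ⟨⟨t, ?_⟩, mem_elementsOf.2 hFt⟩
  simp only [elements, Finset.mem_filter, Set.Finite.mem_toFinset]
  exact ⟨ht, hc⟩

open Topology Filter in
/-- Close to the barycenter of a face, each element containing the face contains one side of it. -/
lemma eventually_mem_interior (n : M.FaceNormals) {F : Finset (Pt (m + 1))} (hF : F ∈ M.meshFaces)
    {T : M.Elt} (hT : T ∈ M.elementsOf F) :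
    (∀ᶠ t : ℝ in 𝓝[>] 0, ((m : ℝ) + 1)⁻¹ • ∑ x ∈ F, x + t • n.normal F ∈ interior (cell T.1)) ∨
    ∀ᶠ t : ℝ in 𝓝[<] 0, ((m : ℝ) + 1)⁻¹ • ∑ x ∈ F, x + t • n.normal F ∈ interior (cell T.1) := by
  classical
  obtain ⟨i, rfl⟩ := exists_eltFace_eq hF (mem_elementsOf.1 hT)
  set ν := n.normal (eltFace T i) with hν
  set b : Pt (m + 1) := ((m : ℝ) + 1)⁻¹ • ∑ x ∈ eltFace T i, x with hb
  let B := eltBasis T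
  have hbmap : b = simplexMap (B ∘ i.succAbove) (WithLp.toLp 2 fun _ => ((m : ℝ) + 1)⁻¹) := by
    have hr : ∀ l, refCoord m l (WithLp.toLp 2 fun _ => ((m : ℝ) + 1)⁻¹) = ((m : ℝ) + 1)⁻¹ := by
      intro l
      refine Fin.cases ?_ (fun j => ?_) l
      · have : (m : ℝ) + 1 ≠ 0 := by positivity
        simp only [refCoord_zero, Finset.sum_const, Finset.card_univ, Fintype.card_fin,
          nsmul_eq_mul]
        field_simp
        ring
      · rfl
    simp only [simplexMap, hr, ← Finset.smul_sum]
    rw [hb, eltFace, Finset.sum_image fun x _ y _ hxy =>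
      (B.ind.injective.comp Fin.succAbove_right_injective) hxy]
  have hbi : B.coord i b = 0 := by
    rw [hbmap]
    exact coord_simplexMap_eq_zero (fun l => Fin.succAbove_ne i l) _
  have hbl : ∀ l, l ≠ i → 0 < B.coord l b := fun l hl => by
    obtain ⟨j, rfl⟩ := Fin.exists_succAbove_eq hl
    rw [hbmap, coord_simplexMap Fin.succAbove_right_injective]
    refine Fin.cases ?_ (fun j => ?_) j
    · have : (m : ℝ) + 1 ≠ 0 := by positivity
      have h1 : 1 - (m : ℝ) * ((m : ℝ) + 1)⁻¹ = ((m : ℝ) + 1)⁻¹ := by field_simp; ring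
      simp only [refCoord_zero, Finset.sum_const, Finset.card_univ, Fintype.card_fin,
        nsmul_eq_mul, h1]
      positivity
    · rw [refCoord_succ]
      positivity
  have hlin : ∀ t : ℝ, B.coord i (b + t • ν) = t * B.coord i (b + ν) := fun t => by
    have h1 : ∀ v, B.coord i (b + v) = (B.coord i).linear v := fun v => by
      have := (B.coord i).map_vadd b v
      rw [hbi] at this
      simpa [add_comm] using this
    rw [h1, h1, map_smul, smul_eq_mul]
  -- The normal is not tangential to the face, so that it changes the coordinate of the vertex `i`.
  have hcoord0 : B.coord i (b + ν) ≠ 0 := by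
    intro h0
    obtain ⟨j, hj⟩ : ∃ j, j ≠ i := ⟨i.succAbove 0, Fin.succAbove_ne _ _⟩
    have horth := normal_orthogonal n T i
    have h1 := inner_sub_vertex horth hj (b + ν)
    have h2 := inner_sub_vertex horth hj b
    change ⟪ν, b + ν - B j⟫ = B.coord i (b + ν) * _ at h1
    change ⟪ν, b - B j⟫ = B.coord i b * _ at h2
    rw [h0, zero_mul, add_sub_right_comm, inner_add_right, h2, hbi, zero_mul, zero_add,
      real_inner_self_eq_norm_sq, n.norm_normal _ hF] at h1
    norm_num at h1
  have hev : ∀ᶠ t : ℝ in 𝓝 0, ∀ l, l ≠ i → 0 < B.coord l (b + t • ν) := by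
    refine eventually_all.2 fun l => ?_
    by_cases hl : l = i
    · simp [hl]
    · have hc : Continuous fun t : ℝ => B.coord l (b + t • ν) :=
        (B.coord l).continuous_of_finiteDimensional.comp (by fun_prop)
      have := hc.continuousAt (x := (0 : ℝ)) |>.eventually (lt_mem_nhds (a := 0)
        (by simpa using hbl l hl))
      filter_upwards [this] with t ht _ using ht
  have hint : interior (cell T.1) = {x | ∀ l, 0 < B.coord l x} := by
    rw [cell_eq, B.interior_convexHull]
  rw [hint]
  rcases hcoord0.lt_or_gt with hneg | hpos
  · right
    filter_upwards [nhdsWithin_le_nhds hev, self_mem_nhdsWithin] with t ht ht0 l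
    by_cases hl : l = i
    · rw [hl, hlin]
      exact mul_pos_of_neg_of_neg ht0 hneg
    · exact ht l hl
  · left
    filter_upwards [nhdsWithin_le_nhds hev, self_mem_nhdsWithin] with t ht ht0 l
    by_cases hl : l = i
    · rw [hl, hlin]
      exact mul_pos ht0 hpos
    · exact ht l hl

open Topology Filter in
/-- A face belongs to at most two elements, since elements on the same side of it overlap. -/
lemma card_elementsOf_le_two (n : M.FaceNormals) {F : Finset (Pt (m + 1))} (hF : F ∈ M.meshFaces) :
    (M.elementsOf F).card ≤ 2 := by
  classical
  let Q : Filter ℝ → M.Elt → Prop := fun l T =>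
    ∀ᶠ t : ℝ in l, ((m : ℝ) + 1)⁻¹ • ∑ x ∈ F, x + t • n.normal F ∈ interior (cell T.1)
  have hone : ∀ l : Filter ℝ, l.NeBot → ((M.elementsOf F).filter (Q l)).card ≤ 1 := by
    intro l hl
    refine Finset.card_le_one.2 fun T hT T' hT' => ?_
    obtain ⟨t, ht, ht'⟩ := ((Finset.mem_filter.1 hT).2.and (Finset.mem_filter.1 hT').2).exists
    exact interior_cell_disjoint ht ht'
  have hsub : M.elementsOf F ⊆ (M.elementsOf F).filter (Q (𝓝[>] 0)) ∪
      (M.elementsOf F).filter (Q (𝓝[<] 0)) := fun T hT => by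
    rw [Finset.mem_union, Finset.mem_filter, Finset.mem_filter]
    exact (eventually_mem_interior n hF hT).imp (fun h => ⟨hT, h⟩) fun h => ⟨hT, h⟩
  calc _ ≤ _ := Finset.card_le_card hsub
    _ ≤ _ := Finset.card_union_le _ _
    _ ≤ 1 + 1 := add_le_add (hone _ inferInstance) (hone _ inferInstance)

/-! ### From the global lifting to its restrictions to the elements -/

lemma evalVec_mem_polyFun (v : M.BrokenPoly k (Fin (m + 1))) (T : M.Elt) :
    evalVec v T ∈ polyFun (m + 1) k (Pt (m + 1)) := by
  have h : evalVec v T = ∑ i, fun x : Pt (m + 1) =>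
      MvPolynomial.eval x.ofLp (v T i : MvPolynomial (Fin (m + 1)) ℝ) •
        (EuclideanSpace.single i (1 : ℝ)) := by
    ext x j
    simp [evalVec, Finset.sum_apply, Pi.single_apply]
  rw [h]
  exact Submodule.sum_mem _ fun i _ => eval_smul_mem_polyFun
    ((MvPolynomial.mem_restrictTotalDegree _ _ _).1 (v T i).2) _

lemma evalMat_mem_polyFun (τ : M.BrokenPoly k (Fin (m + 1) × Fin (m + 1))) (T : M.Elt) :
    evalMat τ T ∈ polyFun (m + 1) k (Matrix (Fin (m + 1)) (Fin (m + 1)) ℝ) := by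
  have h : evalMat τ T = ∑ i, ∑ j, fun x : Pt (m + 1) =>
      MvPolynomial.eval x.ofLp (τ T (i, j) : MvPolynomial (Fin (m + 1)) ℝ) •
        (Matrix.single i j (1 : ℝ)) := by
    ext x a b
    simp only [Finset.sum_apply, Matrix.sum_apply, Matrix.smul_apply, Matrix.single_apply,
      evalMat, Matrix.of_apply, smul_eq_mul]
    rw [Finset.sum_eq_single a (by simp +contextual) (by simp),
      Finset.sum_eq_single b (by simp +contextual) (by simp)]
    simp
  rw [h]
  exact Submodule.sum_mem _ fun i _ => Submodule.sum_mem _ fun j _ => eval_smul_mem_polyFun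
    ((MvPolynomial.mem_restrictTotalDegree _ _ _).1 (τ T (i, j)).2) _

lemma jump_mem_polyFun (n : M.FaceNormals) (F : Finset (Pt (m + 1)))
    (v : M.BrokenPoly k (Fin (m + 1))) :
    jump n F (evalVec v) ∈ polyFun (m + 1) k (Pt (m + 1)) := by
  classical
  have h : jump n F (evalVec v) = ∑ T ∈ M.elementsOf F,
      (if PointsOut (n.normal F) F T.1 then (1 : ℝ) else -1) • evalVec v T := by
    ext1 x
    simp only [jump, Finset.sum_apply, Pi.smul_apply]
  rw [h]
  exact Submodule.sum_mem _ fun T _ => Submodule.smul_mem _ _ (evalVec_mem_polyFun v T)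

lemma integrableOn_cell_meshFace {F : Finset (Pt (m + 1))} (hF : F ∈ M.meshFaces)
    {g : Pt (m + 1) → Pt (m + 1)} (hg : Continuous g) : IntegrableOn g (cell F) μHE[m] := by
  obtain ⟨T, hT⟩ := elementsOf_nonempty hF
  obtain ⟨i, rfl⟩ := exists_eltFace_eq hF (mem_elementsOf.1 hT)
  rw [cell_eltFace]
  refine integrableOn_convexHull (lipschitzWith_simplexMap
    (h := Metric.diam (Set.range (eltBasis T ∘ i.succAbove))) Metric.diam_nonneg fun j l =>
      Metric.dist_le_diam_of_mem (Set.finite_range _).isBounded ⟨j, rfl⟩ ⟨l, rfl⟩) hg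

lemma setIntegral_indicator_interior_cell (hΩ : IsPolytopalDomain Ω) (T : M.Elt)
    (g : Pt (m + 1) → ℝ) :
    ∫ x in Ω, (interior (cell T.1)).indicator g x =
      ∫ x in convexHull ℝ (Set.range (eltBasis T)), g x := by
  rw [setIntegral_indicator isOpen_interior.measurableSet,
    Set.inter_eq_self_of_subset_right (interior_cell_subset hΩ T), ← cell_eq]
  refine setIntegral_congr_set (interior_ae_eq_of_null_frontier ?_)
  exact (convex_convexHull ℝ _).addHaar_frontier _

lemma glue_eq_zero {V : Type*} [AddCommGroup V] (v : M.Elt → Pt (m + 1) → V) {x : Pt (m + 1)}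
    (hx : ∀ T : M.Elt, x ∉ interior (cell T.1)) : glue v x = 0 :=
  Finset.sum_eq_zero fun T _ => Set.indicator_of_notMem (hx T) _

/-- The `L^q` norm of a broken tensor polynomial is the sum of those of its restrictions. -/
lemma integral_norm_glue_rpow (hΩ : IsPolytopalDomain Ω) {q : ℝ} (hq : 1 ≤ q)
    (τ : M.BrokenPoly k (Fin (m + 1) × Fin (m + 1))) :
    ∫ x in Ω, ‖glue (evalMat τ) x‖ ^ q =
      ∑ T : M.Elt, ∫ x in convexHull ℝ (Set.range (eltBasis T)), ‖evalMat τ T x‖ ^ q := by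
  classical
  have hpt : ∀ x, ‖glue (evalMat τ) x‖ ^ q = ∑ T : M.Elt, (interior (cell T.1)).indicator
      (fun x => ‖evalMat τ T x‖ ^ q) x := fun x => by
    by_cases hx : ∃ T : M.Elt, x ∈ interior (cell T.1)
    · obtain ⟨T, hT⟩ := hx
      rw [glue_eq _ hT, Finset.sum_eq_single T]
      · rw [Set.indicator_of_mem hT]
      · intro T' _ hne
        exact Set.indicator_of_notMem (fun h => hne (interior_cell_disjoint h hT)) _
      · simp
    · push Not at hx
      rw [glue_eq_zero _ hx, norm_zero, Real.zero_rpow (by linarith)]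
      exact (Finset.sum_eq_zero fun T _ => Set.indicator_of_notMem (hx T) _).symm
  simp only [hpt]
  rw [integral_finsetSum]
  · exact Finset.sum_congr rfl fun T _ => setIntegral_indicator_interior_cell hΩ T _
  · intro T _
    have hc : Continuous fun x => ‖evalMat τ T x‖ ^ q :=
      (continuous_of_mem_polyFun (evalMat_mem_polyFun τ T)).norm.rpow_const
        fun _ => Or.inr (by linarith)
    have hi : IntegrableOn (fun x => ‖evalMat τ T x‖ ^ q) (interior (cell T.1)) :=
      (hc.continuousOn.integrableOn_compact (isCompact_cell T.1)).mono_set interior_subset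
    exact (hi.integrable_indicator isOpen_interior.measurableSet).restrict

open Classical in
/-- The broken tensor polynomial which is `p` on the element `T` and zero on the others. -/
def extendByZero (T : M.Elt)
    (p : Fin (m + 1) × Fin (m + 1) → MvPolynomial.restrictTotalDegree (Fin (m + 1)) ℝ k) :
    M.BrokenPoly k (Fin (m + 1) × Fin (m + 1)) := Function.update 0 T p

/-- The restriction of the lifting to an element is the lifting of the jumps on its faces. -/
lemma isElementLifting_jumpLifting (hΩ : IsPolytopalDomain Ω) (n : M.FaceNormals)
    (v : M.BrokenPoly k (Fin (m + 1))) (T : M.Elt) :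
    IsElementLifting k (eltBasis T) (fun i => n.normal (eltFace T i))
      (fun i => ((M.elementsOf (eltFace T i)).card : ℝ)⁻¹)
      (fun i => jump n (eltFace T i) (evalVec v))
      (evalMat (jumpLifting k n (evalVec v)) T) := by
  classical
  refine ⟨fun i => n.norm_normal _ (eltFace_mem_meshFaces T i), normal_orthogonal n T,
    fun i => ?_, fun i => ?_, fun i => jump_mem_polyFun n _ v, evalMat_mem_polyFun _ T,
    fun τ hτ => ?_⟩
  · rw [one_div]
    refine inv_anti₀ ?_ ?_
    · exact_mod_cast (elementsOf_nonempty (eltFace_mem_meshFaces T i)).card_pos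
    · exact_mod_cast card_elementsOf_le_two n (eltFace_mem_meshFaces T i)
  · refine inv_le_one_of_one_le₀ ?_
    exact_mod_cast (elementsOf_nonempty (eltFace_mem_meshFaces T i)).card_pos
  obtain ⟨p, hp⟩ := exists_eval_eq_of_mem_polyFun hτ
  have hτT : evalMat (extendByZero T p) T = τ := by
    ext x i j
    simp [evalMat, extendByZero, hp]
  have hτne : ∀ T' : M.Elt, T' ≠ T → ∀ x, evalMat (extendByZero T p) T' x = 0 := by
    intro T' hne x
    ext i j
    simp [evalMat, extendByZero, hne]
  set R := jumpLifting k n (evalVec v) with hR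
  have hleft : l2Form hΩ k R (extendByZero T p) =
      ∫ x in convexHull ℝ (Set.range (eltBasis T)), frobProd (evalMat R T x) (τ x) := by
    rw [← setIntegral_indicator_interior_cell hΩ T]
    change ∫ x in Ω, frobProd (glue (evalMat R) x) (glue (evalMat (extendByZero T p)) x) = _
    congr 1
    ext x
    by_cases hx : ∃ T' : M.Elt, x ∈ interior (cell T'.1)
    · obtain ⟨T', hT'⟩ := hx
      rw [glue_eq _ hT', glue_eq _ hT']
      rcases eq_or_ne T' T with rfl | hne
      · rw [Set.indicator_of_mem hT', hτT]
      · rw [hτne T' hne, Set.indicator_of_notMem fun h => hne (interior_cell_disjoint hT' h)]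
        simp [frobProd]
    · push Not at hx
      rw [glue_eq_zero _ hx, Set.indicator_of_notMem (hx T)]
      simp [frobProd]
  have havg : ∀ (F : Finset (Pt (m + 1))) (x : Pt (m + 1)), avg F (evalMat (extendByZero T p)) x =
      if T ∈ M.elementsOf F then ((M.elementsOf F).card : ℝ)⁻¹ • τ x else 0 := fun F x => by
    rw [avg]
    split_ifs with hT
    · rw [Finset.sum_eq_single T (fun T' _ hne => hτne T' hne x) (fun h => absurd hT h), hτT]
    · rw [Finset.sum_eq_zero fun T' hT' => hτne T' (fun h => hT (h ▸ hT')) x, smul_zero]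
  have hright : ∀ F ∈ M.meshFaces,
      l2Form hΩ k (faceLifting k n F (jump n F (evalVec v))) (extendByZero T p) =
      if T ∈ M.elementsOf F then ((M.elementsOf F).card : ℝ)⁻¹ *
        ∫ x in cell F, ⟪jump n F (evalVec v) x,
          (WithLp.toLp 2 ((τ x).mulVec (n.normal F).ofLp) : Pt (m + 1))⟫ ∂μHE[m] else 0 := by
    intro F hF
    have h1 := isFaceLifting_faceLifting hΩ k n F (jump n F (evalVec v))
      (integrableOn_cell_meshFace hF (continuous_of_mem_polyFun (jump_mem_polyFun n F v)))
      (extendByZero T p)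
    refine h1.trans ?_
    simp only [havg]
    split_ifs with hT
    · rw [← integral_const_mul]
      congr 1
      ext x
      rw [Matrix.smul_mulVec, WithLp.toLp_smul, inner_smul_right]
    · simp
  rw [← hleft, hR, jumpLifting, map_sum, LinearMap.sum_apply, Finset.sum_congr rfl hright,
    sum_eltFace T fun F => ((M.elementsOf F).card : ℝ)⁻¹ *
        ∫ x in cell F, ⟪jump n F (evalVec v) x,
          (WithLp.toLp 2 ((τ x).mulVec (n.normal F).ofLp) : Pt (m + 1))⟫ ∂μHE[m]]
  simp only [cell_eltFace]

/-- Summing over the faces of each element counts every mesh face once or twice. -/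
lemma sum_elt_sum_face_bounds (n : M.FaceNormals) {g : Finset (Pt (m + 1)) → ℝ}
    (hg : ∀ F, 0 ≤ g F) :
    ∑ F ∈ M.meshFaces, g F ≤ ∑ T : M.Elt, ∑ i, g (eltFace T i) ∧
      ∑ T : M.Elt, ∑ i, g (eltFace T i) ≤ 2 * ∑ F ∈ M.meshFaces, g F := by
  classical
  have h : ∑ T : M.Elt, ∑ i, g (eltFace T i) =
      ∑ F ∈ M.meshFaces, ((M.elementsOf F).card : ℝ) * g F := by
    simp only [← sum_eltFace]
    rw [Finset.sum_comm]
    refine Finset.sum_congr rfl fun F _ => ?_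
    rw [← Finset.sum_filter, Finset.sum_const, nsmul_eq_mul, Finset.filter_univ_mem]
  rw [h, Finset.mul_sum]
  refine ⟨Finset.sum_le_sum fun F hF => ?_, Finset.sum_le_sum fun F hF => ?_⟩
  · refine le_mul_of_one_le_left (hg F) ?_
    exact_mod_cast (elementsOf_nonempty hF).card_pos
  · refine mul_le_mul_of_nonneg_right ?_ (hg F)
    exact_mod_cast card_elementsOf_le_two n hF

lemma IsRegular.shapeRegular {ϱ : ℝ} (hM : M.IsRegular ϱ) (T : M.Elt) :
    ShapeRegular (eltBasis T) (4 * max ϱ 1) (Metric.diam (cell T.1)) := by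
  obtain ⟨x, r, hr, hball, hdiam⟩ := hM T.1 T.2
  rw [cell_eq] at hball hdiam ⊢
  exact shapeRegular_of_ball (Nat.succ_ne_zero m) hr hball (hdiam.trans (by
    gcongr
    exact le_max_left _ _))

end Mesh

end SimplicialMesh

end HdivDG
end

theorem mainTheorem4 (d : ℕ) (hd : d = 2 ∨ d = 3) (k : ℕ) (hk : 1 ≤ k) (q : ℝ) (hq : 1 ≤ q)
    (ϱ : ℝ) :
    ∃ c C : ℝ, 0 < c ∧ 0 < C ∧
      ∀ (Ω : Set (HdivDG.Pt d)), HdivDG.IsPolytopalDomain Ω →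
      ∀ (M : HdivDG.SimplicialMesh Ω), M.IsRegular ϱ →
      ∀ (n : M.FaceNormals), ∀ v ∈ HdivDG.SimplicialMesh.velocitySpace n k,
        let R := HdivDG.SimplicialMesh.glue (HdivDG.SimplicialMesh.evalMat
          (HdivDG.SimplicialMesh.jumpLifting k n (HdivDG.SimplicialMesh.evalVec v)))
        let S := ∑ F ∈ M.meshFaces, Metric.diam (HdivDG.cell F) ^ (1 - q) *
          ∫ x in HdivDG.cell F,
            ‖HdivDG.SimplicialMesh.jump n F (HdivDG.SimplicialMesh.evalVec v) x‖ ^ q ∂μHE[d - 1]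
        c * S ≤ ∫ x in Ω, ‖R x‖ ^ q ∧ ∫ x in Ω, ‖R x‖ ^ q ≤ C * S := by
  obtain ⟨m, rfl, hm⟩ : ∃ m, d = m + 1 ∧ m ≠ 0 := by
    rcases hd with rfl | rfl
    · exact ⟨1, rfl, one_ne_zero⟩
    · exact ⟨2, rfl, two_ne_zero⟩
  have hA : 0 < 4 * max ϱ 1 := by positivity
  obtain ⟨C₁, hC₁, hlow⟩ := HdivDG.exists_sum_face_le hm hk hq hA
  obtain ⟨C₂, hC₂, hupp⟩ := HdivDG.exists_integral_lifting_le (k := k) hm hq hA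
  refine ⟨C₁⁻¹, C₂ * 2, by positivity, by positivity, fun Ω hΩ M hM n v _ => ?_⟩
  intro R S
  let g : Finset (HdivDG.Pt (m + 1)) → ℝ := fun F => Metric.diam (HdivDG.cell F) ^ (1 - q) *
    ∫ x in HdivDG.cell F,
      ‖HdivDG.SimplicialMesh.jump n F (HdivDG.SimplicialMesh.evalVec v) x‖ ^ q ∂μHE[m]
  have hg : ∀ F, 0 ≤ g F := fun F => mul_nonneg (Real.rpow_nonneg Metric.diam_nonneg _)
    (MeasureTheory.integral_nonneg fun x => Real.rpow_nonneg (norm_nonneg _) _)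
  obtain ⟨h1, h2⟩ := HdivDG.SimplicialMesh.sum_elt_sum_face_bounds n hg
  have hS : S = ∑ F ∈ M.meshFaces, g F := rfl
  have hR := HdivDG.SimplicialMesh.integral_norm_glue_rpow hΩ hq
    (HdivDG.SimplicialMesh.jumpLifting k n (HdivDG.SimplicialMesh.evalVec v))
  have hlift := HdivDG.SimplicialMesh.isElementLifting_jumpLifting hΩ n v
  constructor
  · rw [inv_mul_le_iff₀ hC₁, hS, hR, Finset.mul_sum]
    refine h1.trans (Finset.sum_le_sum fun T _ => ?_)
    simpa only [g, HdivDG.SimplicialMesh.cell_eltFace] using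
      hlow (hM.shapeRegular T) (hlift T)
  · rw [hS, hR, mul_assoc]
    refine le_trans ?_ (mul_le_mul_of_nonneg_left h2 hC₂.le)
    rw [Finset.mul_sum]
    refine Finset.sum_le_sum fun T _ => ?_
    simpa only [g, HdivDG.SimplicialMesh.cell_eltFace] using
      hupp (hM.shapeRegular T) (hlift T)
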